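/- **General construction.** Let $L$ be a relational language containing a binary symbol $E$, and let $M_0$ be an $L$-structure in which $E$ is an equivalence relation with exactly $\omega$ many classes, all finite and of strictly increasing sizes. Let $L'$ be the relational language with a $2n$-ary symbol $R'$ for each $n$-ary symbol $R$ of $L$, binary symbols $\tilde E, S$ and a $4$-ary symbol $U$. Call an $L'$-structure $N_0$ a *coding* of $M_0$ if it arises as follows. $\tilde E$ is an equivalence relation on $N_0$ whose classes are finite and correspond bijectively to the $E$-classes of $M_0$. $S$ is the edge relation of a graph without edges between distinct $\tilde E$-classes, and on the $\tilde E$-class $\tilde{\mathfrak e}$ corresponding to an $E$-class $\mathfrak e$ of size $n$ this graph is regular of degree $n$ and has no cycles of length $\le n$. $U$ is an equivalence relation on the edges, $U$-equivalent edges lie in the same $\tilde E$-class, every vertex of $\tilde{\mathfrak e}$ lies on exactly one edge from each $U$-class of edges of $\tilde{\mathfrak e}$, and a bijection $\pi$ is fixed between the $U$-classes of edges of $\tilde{\mathfrak e}$ and the elements of $\mathfrak e$. Finally, $R'(x_1,y_1,\dots,x_n,y_n)$ holds iff $S(x_i,y_i)$ for all $i$ and $M_0\models R(\pi(x_1,y_1),\dots,\pi(x_n,y_n))$.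 Then codings of $M_0$ exist, and for every coding $N_0$ of $M_0$: 1. if $\mathrm{Th}(M_0)$ is NIP, then $\mathrm{Th}(N_0)$ is NIP; 2. if all imaginary types over $M_0$ of a new $E$-class are definable, then all $1$-types over $N_0$ are definable. (The imaginary type of the $E$-class of an element $c\notin\bigcup_{b\in M_0}b/E$ of an elementary extension consists of the formulas $\varphi(x,b)$, $b\in M_0$, true of $c$, with $\varphi(x,y)$ invariant under $E$ in the single variable $x$.) **Example.** Let $M_0$ be the full binary tree $2^{<\omega}$ in the language $\{\le,E\}$, where $\le$ is the tree order and $E$ is the relation of having the same distance from the root. Then $M_0$ has codings, and for every coding $N_0$ of $M_0$, with $T'=\mathrm{Th}(N_0)$: * $T'$ is NIP; * all $1$-types over $N_0$ are definable, but for every $n\ge 2$ there is an $n$-type over $N_0$ that is not definable; * $N_0$ is $(\infty,1)$-stably embedded in every elementary extension, but there is an elementary extension in which, for every $m\ge2$, it is not $(\infty,m)$-stably embedded. Here a subset $A$ of a structure $N$ is $(\infty,m)$-stably embedded in $N$ if for every $n$, every subset of $A^n$ of the form $\varphi(A,a)$ with $a$ a tuple from $N$ of length $\le m$ is of the form $\psi(A,b)$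 with $b$ a tuple from $A$. In particular, in NIP theories $(\infty,1)$-stable embeddedness of a model does not imply its $(\infty,m)$-stable embeddedness for any $m\ge2$. -/

import Mathlib

open FirstOrder FirstOrder.Language

namespace GraphCoding

/-! ### NIP, definable types, stable embeddedness -/

/-- A theory is NIP if no formula `φ(x; y)` has, in any model, tuples `a_t` (`t ∈ ω`) and
`b_s` (`s ⊆ ω`) such that `φ(a_t; b_s)` holds if and only if `t ∈ s`. -/
def IsNIP {L : FirstOrder.Language.{0, 0}} (T : L.Theory) : Prop :=
  ∀ (n m : ℕ) (φ : L.Formula (Fin n ⊕ Fin m)) (M : Type) [L.Structure M] [Nonempty M], M ⊨ T →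
    ¬ ∃ (a : ℕ → Fin n → M) (b : Set ℕ → Fin m → M),
      ∀ (t : ℕ) (s : Set ℕ), φ.Realize (Sum.elim (a t) (b s)) ↔ t ∈ s

/-- The space `S_n(M)` of complete `n`-types over `M`. -/
abbrev TypeOver (L : FirstOrder.Language.{0, 0}) (M : Type) [L.Structure M] (n : ℕ) : Type :=
  (L.elementaryDiagram M).CompleteType (Fin n)

/-- The formula `φ(x; b)` with parameters `b` from `M`, where the variables `x` are replaced by
the constants by which Mathlib represents the variables of a complete type. -/
def plug {L : FirstOrder.Language.{0, 0}} {M : Type} {n m : ℕ} (φ : L.Formula (Fin n ⊕ Fin m))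
    (b : Fin m → M) : (L[[M]])[[Fin n]].Sentence :=
  Formula.equivSentence
    (((L.lhomWithConstants M).onFormula φ).subst
      (Sum.elim (fun i => Term.var i) (fun j => Constants.term (L.con (b j)))))

/-- The set `{b ∈ M^m : φ(x; b) ∈ p}` attached to a type `p` over `M` and a formula `φ(x; y)`. -/
def defSet {L : FirstOrder.Language.{0, 0}} {M : Type} [L.Structure M] {n m : ℕ} (p : TypeOver L M n)
    (φ : L.Formula (Fin n ⊕ Fin m)) : Set (Fin m → M) :=
  {b | plug φ b ∈ p}

/-- A type over `M` is definable if for every `φ(x; y)` the set `{b : φ(x; b) ∈ p}` is definable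
in `M` with parameters from `M`. -/
def IsDefinableType {L : FirstOrder.Language.{0, 0}} {M : Type} [L.Structure M] {n : ℕ}
    (p : TypeOver L M n) : Prop :=
  ∀ (m : ℕ) (φ : L.Formula (Fin n ⊕ Fin m)), (Set.univ : Set M).Definable L (defSet p φ)

/-- `A ⊆ M` is `(n, m)`-stably embedded in `M`: every subset of `A^n` of the form `φ(A, a)` with
`a` from `M` and `|a| ≤ m` is of the form `ψ(A, b)` with `b` from `A`. -/
def StablyEmbedded (L : FirstOrder.Language.{0, 0}) {M : Type} [L.Structure M] (A : Set M) (n m : ℕ) : Prop :=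
  ∀ k ≤ m, ∀ (φ : L.Formula (Fin n ⊕ Fin k)) (a : Fin k → M),
    ∃ (l : ℕ) (ψ : L.Formula (Fin n ⊕ Fin l)) (b : Fin l → M), (∀ j, b j ∈ A) ∧
      ∀ x : Fin n → M, (∀ i, x i ∈ A) →
        (φ.Realize (Sum.elim x a) ↔ ψ.Realize (Sum.elim x b))

/-- `(∞, m)`-stable embeddedness. -/
def InfStablyEmbedded (L : FirstOrder.Language.{0, 0}) {M : Type} [L.Structure M] (A : Set M) (m : ℕ) : Prop :=
  ∀ n : ℕ, StablyEmbedded L A n m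

/-! ### The general construction -/

/-- The relation `E` of `M` is an equivalence relation with `ω` many classes, the `k`-th one being
`{a | lev a = k}`; the classes are finite, of strictly increasing sizes. -/
structure Layering {L : FirstOrder.Language.{0, 0}} (M : Type) [L.Structure M] (E : L.Relations 2) where
  lev : M → ℕ
  rel_iff : ∀ a b : M, Structure.RelMap E ![a, b] ↔ lev a = lev b
  nonempty : ∀ k : ℕ, {a : M | lev a = k}.Nonempty
  finite : ∀ k : ℕ, {a : M | lev a = k}.Finite
  strictMono : StrictMono fun k : ℕ => {a : M | lev a = k}.ncard

/-- The size of the `k`-th class. -/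
noncomputable def Layering.size {L : FirstOrder.Language.{0, 0}} {M : Type} [L.Structure M]
    {E : L.Relations 2} (D : Layering M E) (k : ℕ) : ℕ :=
  {a : M | D.lev a = k}.ncard

/-- The data of which the structure `N₀` is made: a graph `S` on `V`, split into finite pieces
(the classes of `Ẽ`, given by `lev`), one for each `E`-class of `M`. The piece for a class of size
`n` is `n`-regular without cycles of length at most `n`. Edges carry an equivalence
relation `U`, whose classes are matched by `π` with the elements of `M`, so that the `U`-classes of
edges in the `k`-th piece correspond to the elements of the `k`-th `E`-class, and every vertex is
on exactly one edge from each `U`-class of its piece. -/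
structure Coding {L : FirstOrder.Language.{0, 0}} {M : Type} [L.Structure M] {E : L.Relations 2}
    (D : Layering M E) where
  V : Type
  lev : V → ℕ
  nonempty : ∀ k : ℕ, {v : V | lev v = k}.Nonempty
  finite : ∀ k : ℕ, {v : V | lev v = k}.Finite
  S : SimpleGraph V
  lev_eq_of_adj : ∀ u v : V, S.Adj u v → lev u = lev v
  regular : ∀ v : V, (S.neighborSet v).ncard = D.size (lev v)
  no_short_cycle : ∀ (v : V) (c : S.Walk v v), c.IsCycle → D.size (lev v) < c.length
  U : Setoid S.edgeSet
  π : Quotient U ≃ M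
  lev_π : ∀ e : S.edgeSet, ∀ v ∈ (e : Sym2 V), D.lev (π (Quotient.mk U e)) = lev v
  existsUnique_edge : ∀ (v : V) (q : Quotient U), D.lev (π q) = lev v →
    ∃! e : S.edgeSet, v ∈ (e : Sym2 V) ∧ Quotient.mk U e = q

/-- The relation symbols of `L'`: a symbol `R'` of arity `2n` for every `n`-ary symbol `R` of `L`,
and `Ẽ`, `S`, `U`. -/
inductive CodeRel (L : FirstOrder.Language.{0, 0}) : ℕ → Type
  | coded {n : ℕ} (R : L.Relations n) : CodeRel L (n * 2)
  | cls : CodeRel L 2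
  | edge : CodeRel L 2
  | par : CodeRel L 4

/-- The relational language `L'`. -/
def codeLanguage (L : FirstOrder.Language.{0, 0}) : FirstOrder.Language.{0, 0} where
  Functions := fun _ => Empty
  Relations := CodeRel L

section

variable {L : FirstOrder.Language.{0, 0}} {M : Type} [L.Structure M] {E : L.Relations 2} {D : Layering M E}

/-- The element of `M` coded by the edge between `u` and `v`. -/
def Coding.color (C : Coding D) {u v : C.V} (h : C.S.Adj u v) : M :=
  C.π (Quotient.mk C.U ⟨s(u, v), h⟩)

/-- Interpretation of the symbols of `L'`. A tuple of length `2n` is read as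
`(x₁, y₁, …, xₙ, yₙ)`; `finProdFinEquiv (i, 0)` and `finProdFinEquiv (i, 1)` are
the positions of `xᵢ` and `yᵢ`. -/
def Coding.relMap (C : Coding D) : ∀ {n : ℕ}, CodeRel L n → (Fin n → C.V) → Prop
  | _, .coded R, v =>
      ∃ h : ∀ i, C.S.Adj (v (finProdFinEquiv (i, 0))) (v (finProdFinEquiv (i, 1))),
        Structure.RelMap R fun i => C.color (h i)
  | _, .cls, v => C.lev (v 0) = C.lev (v 1)
  | _, .edge, v => C.S.Adj (v 0) (v 1)
  | _, .par, v => ∃ (h : C.S.Adj (v 0) (v 1)) (h' : C.S.Adj (v 2) (v 3)),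
      C.U.r ⟨s(v 0, v 1), h⟩ ⟨s(v 2, v 3), h'⟩

/-- The `L'`-structure `N₀`. -/
instance Coding.instStructure (C : Coding D) : (codeLanguage L).Structure C.V where
  funMap := fun f => Empty.elim f
  RelMap := fun R v => C.relMap R v

end

/-- All imaginary types over `M` of a new `E`-class are definable. Such an imaginary type is given
by the formulas `φ(x; b)`, with `φ(x; y)` invariant under `E` in the single variable `x`, in a
`1`-type `p(x)` over `M` that contains no formula `E(x, b)` with `b ∈ M`. -/
def NewClassTypesDefinable {L : FirstOrder.Language.{0, 0}} (M : Type) [L.Structure M]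
    (E : L.Relations 2) : Prop :=
  ∀ p : TypeOver L M 1,
    (∀ b : M, plug (E.formula₂ (Term.var (Sum.inl 0)) (Term.var (Sum.inr 0)) :
      L.Formula (Fin 1 ⊕ Fin 1)) ![b] ∉ p) →
    ∀ (m : ℕ) (φ : L.Formula (Fin 1 ⊕ Fin m)),
      (∀ (a a' : M) (b : Fin m → M), Structure.RelMap E ![a, a'] →
        (φ.Realize (Sum.elim ![a] b) ↔ φ.Realize (Sum.elim ![a'] b))) →
      (Set.univ : Set M).Definable L (defSet p φ)

/-! ### The binary tree with the level equivalence relation -/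

/-- The symbols `≤` and `E`. -/
inductive TreeRel : ℕ → Type
  | le : TreeRel 2
  | eqv : TreeRel 2

/-- The language `L₀ = {≤, E}`. -/
def treeLanguage : FirstOrder.Language.{0, 0} where
  Functions := fun _ => Empty
  Relations := TreeRel

/-- The binary tree of height `ω`: finite binary sequences, `≤` being "is an initial segment
of" and `E` being "has the same length as" (the distance from the root is the length). -/
instance treeStructure : treeLanguage.Structure (List Bool) where
  funMap := fun f => Empty.elim f
  RelMap := fun R v => match R with
    | .le => v 0 <+: v 1
    | .eqv => (v 0).length = (v 1).length

/-- The symbol `E` of `L₀`. -/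
def treeE : treeLanguage.Relations 2 := TreeRel.eqv

theorem ncard_length (k : ℕ) : {l : List Bool | l.length = k}.ncard = 2 ^ k := by
  have h := card_vector (α := Bool) k
  rw [Fintype.card_bool, ← Nat.card_eq_fintype_card] at h
  rw [← h]
  rfl

/-- The levels of the tree. -/
def treeLayering : Layering (List Bool) treeE where
  lev := List.length
  rel_iff := fun _ _ => Iff.rfl
  nonempty := fun k => ⟨List.replicate k true, by simp⟩
  finite := fun k => List.finite_length_eq Bool k
  strictMono := by
    simp only [ncard_length]
    exact pow_right_strictMono₀ (by norm_num)

/-- The language `L'` for `L₀ = {≤, E}`. -/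
abbrev treeCodeLanguage : FirstOrder.Language.{0, 0} := codeLanguage treeLanguage

end GraphCoding

/-!
An element `a` of `M`, called a colour, acts on the vertices of a coding: it moves a vertex along its
edge of colour `a` if there is one, and fixes it otherwise. Quantifiers over vertices can be
eliminated. Given finitely many vertices, a further vertex is either one of the finitely many of low
level, or it is obtained from a given one by a short word of colours, or it is far from all of them;
as there are no short cycles, the far vertices of one high piece cannot be told apart, so that only
the level matters, which is given by an element of `M`. Hence every definable relation between
vertices reduces to the structure `M` on the colours, the levels and the action. By the same
trichotomy the vertices can be traded for elements of `M` one after the other. Applied to the number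
of traces on a finite family of parameters, which in NIP theories is bounded by a polynomial, this
transfers NIP. Applied to a single vertex that realizes a 1-type, it reduces the definability of the
type to that of the type of a new class.

Two vertices, however, may form an edge, which codes an element and thereby an arbitrary 1-type of
`M`. The 1-type over the binary tree of a node on top of the branch `1, 11, 111, …` is not definable,
since the branch is not. On the other hand, a tuple of nodes of the tree is described by the heights
at which its members branch: for a formula only their order and their differences up to a finite
bound matter. This makes the tree NIP, and the types of new levels definable.

Codings exist because the letters of a class act by left multiplication on the ball of reduced words
in the free product of copies of `ℤ/2`. In the induced action on the permutations of this ball, no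
short reduced word has a fixed point, since it moves the empty word.
-/

namespace GraphCoding

section ParamDefinable

universe u v w x y

variable {L : FirstOrder.Language.{u, v}} {M : Type w} [L.Structure M] {γ : Type x} {δ : Type y}

/-- A relation between elements of `M`, indexed by `γ`, that is definable with parameters from `M`.
Predicates in place of sets let the connectives be those of the ambient logic. -/
def ParamDefinable (L : FirstOrder.Language.{u, v}) {M : Type w} [L.Structure M] {γ : Type x}
    (P : (γ → M) → Prop) : Prop :=
  (Set.univ : Set M).Definable L {v | P v}

namespace ParamDefinable

variable {P Q : (γ → M) → Prop}

theorem congr (hP : ParamDefinable L P) (h : ∀ v, P v ↔ Q v) : ParamDefinable L Q := by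
  rwa [← funext fun v => propext (h v)]

theorem of_formula (φ : L.Formula γ) : ParamDefinable L (M := M) φ.Realize :=
  (Set.empty_definable_iff.2 ⟨φ, rfl⟩).mono (Set.empty_subset _)

theorem not (hP : ParamDefinable L P) : ParamDefinable L fun v => ¬ P v :=
  Set.Definable.compl hP

theorem and (hP : ParamDefinable L P) (hQ : ParamDefinable L Q) :
    ParamDefinable L fun v => P v ∧ Q v :=
  Set.Definable.inter hP hQ

theorem or (hP : ParamDefinable L P) (hQ : ParamDefinable L Q) :
    ParamDefinable L fun v => P v ∨ Q v :=
  Set.Definable.union hP hQ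

theorem imp (hP : ParamDefinable L P) (hQ : ParamDefinable L Q) :
    ParamDefinable L fun v => P v → Q v :=
  (hP.not.or hQ).congr fun _ => imp_iff_not_or.symm

theorem subst (hP : ParamDefinable L P) (s : γ → δ ⊕ M) :
    ParamDefinable L fun v : δ → M => P fun g => Sum.elim v id (s g) := by
  obtain ⟨φ, hφ⟩ := hP
  refine ⟨φ.subst fun g => (s g).elim Term.var fun c => (L.con ⟨c, Set.mem_univ c⟩).term,
    Set.ext fun v => ?_⟩
  change (fun g => Sum.elim v id (s g)) ∈ {v | P v} ↔ _
  rw [hφ]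
  refine Iff.trans (iff_of_eq (congrArg φ.Realize (funext fun g => ?_)))
    BoundedFormula.realize_subst.symm
  rcases s g with d | c <;> simp

theorem comp (hP : ParamDefinable L P) (s : γ → δ) :
    ParamDefinable L fun v : δ → M => P fun g => v (s g) :=
  hP.subst fun g => Sum.inl (s g)

theorem ex {P : (Option γ → M) → Prop} (hP : ParamDefinable L P) :
    ParamDefinable L fun v : γ → M => ∃ c, P fun o => o.elim c v := by
  have h : ParamDefinable L fun v : γ ⊕ Unit → M => P fun o => v (o.elim (.inr ()) .inl) :=
    hP.comp _
  refine congr (Q := fun v : γ → M => ∃ c, P fun o => o.elim c v) h.exists_of_finite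
    fun v => ⟨fun ⟨u, hu⟩ => ⟨u (), ?_⟩, fun ⟨c, hc⟩ => ⟨fun _ => c, ?_⟩⟩
  · refine (iff_of_eq (congrArg P (funext fun o => ?_))).1 hu
    cases o <;> rfl
  · refine (iff_of_eq (congrArg P (funext fun o => ?_))).1 hc
    cases o <;> rfl

theorem all {P : (Option γ → M) → Prop} (hP : ParamDefinable L P) :
    ParamDefinable L fun v : γ → M => ∀ c, P fun o => o.elim c v :=
  hP.not.ex.not.congr fun _ => not_exists_not

theorem eq (a b : γ) : ParamDefinable L fun v : γ → M => v a = v b :=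
  (of_formula (Term.equal (Term.var a) (Term.var b))).congr fun v => by
    simp only [Formula.realize_equal, Term.realize_var]

theorem eq_const (a : γ) (c : M) : ParamDefinable L fun v : γ → M => v a = c :=
  (eq (some a) none).subst fun o : Option γ => o.elim (Sum.inr c) Sum.inl

theorem rel {n : ℕ} (R : L.Relations n) (a : Fin n → γ) :
    ParamDefinable L fun v : γ → M => Structure.RelMap R fun i => v (a i) :=
  (of_formula (R.formula fun i => Term.var (a i))).congr fun _ => Formula.realize_rel

theorem exists_formula_fin (hP : ParamDefinable L P) :
    ∃ (n : ℕ) (g : Fin n → γ ⊕ M) (φ : L.Formula (Fin n)),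
      ∀ v, P v ↔ φ.Realize fun i => Sum.elim v id (g i) := by
  classical
  obtain ⟨φ, hφ⟩ := Set.definable_iff_exists_formula_sum.1 hP
  let e := φ.freeVarFinset.equivFin
  let g : (Set.univ : Set M) ⊕ γ → γ ⊕ M := Sum.elim (fun c => .inr c) .inl
  refine ⟨_, fun i => g (e.symm i), φ.restrictFreeVar e, fun v => ?_⟩
  change v ∈ {v | P v} ↔ _
  rw [hφ, Formula.Realize, BoundedFormula.realize_restrictFreeVar (Sum.elim (↑) v)]
  · exact Iff.rfl
  · intro a
    simp only [Equiv.symm_apply_apply]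
    rcases a.1 with c | c <;> rfl

theorem exists_formula_sum [Nonempty M] {P : (γ ⊕ δ → M) → Prop} (hP : ParamDefinable L P) :
    ∃ (m : ℕ) (ψ : L.Formula (γ ⊕ Fin m)) (s : Fin m → δ ⊕ M),
      ∀ x y, P (Sum.elim x y) ↔ ψ.Realize (Sum.elim x fun i => Sum.elim y id (s i)) := by
  obtain ⟨x₀⟩ := ‹Nonempty M›
  obtain ⟨n, g, φ, hφ⟩ := hP.exists_formula_fin
  refine ⟨n, φ.relabel fun i => Sum.elim (Sum.elim .inl fun _ => .inr i) (fun _ => .inr i) (g i),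
    fun i => Sum.elim (Sum.elim (fun _ => .inr x₀) .inl) .inr (g i), fun x y => ?_⟩
  rw [hφ, Formula.realize_relabel]
  refine iff_of_eq (congrArg _ (funext fun i => ?_))
  rcases hg : g i with (a | a) | a <;> simp [hg]

end ParamDefinable

end ParamDefinable

section Ultrafilters

universe u v w x y

variable {L : FirstOrder.Language.{u, v}} {M : Type w} [L.Structure M]
variable {N : Type x} [L.Structure N] {ι : Type y}

/-- The filter on the `ι`-tuples of `M` generated by the sets that are definable over `M` and whose
extensions to `N` contain the tuple `a`. -/
def traceFilter (f : M ↪ₑ[L] N) (a : ι → N) : Filter (ι → M) where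
  sets := {S | ∃ φ : L.Formula (ι ⊕ M), φ.Realize (Sum.elim a f) ∧
    ∀ x, φ.Realize (Sum.elim x id) → x ∈ S}
  univ_sets := ⟨⊤, Formula.realize_top.2 trivial, fun x _ => Set.mem_univ x⟩
  sets_of_superset := fun ⟨φ, h, hS⟩ hST => ⟨φ, h, fun x hx => hST (hS x hx)⟩
  inter_sets := fun ⟨φ, h, hS⟩ ⟨ψ, k, hT⟩ => ⟨φ ⊓ ψ, Formula.realize_inf.2 ⟨h, k⟩, fun x hx =>
    ⟨hS x (Formula.realize_inf.1 hx).1, hT x (Formula.realize_inf.1 hx).2⟩⟩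

instance traceFilter_neBot [Finite ι] (f : M ↪ₑ[L] N) (a : ι → N) : (traceFilter f a).NeBot := by
  refine Filter.neBot_iff.2 fun hbot => ?_
  obtain ⟨φ, h, hφ⟩ : ∅ ∈ traceFilter f a := hbot ▸ Filter.mem_bot
  have hN : ((φ.relabel Sum.swap).iExs ι).Realize (f ∘ id) := by
    rw [Formula.realize_iExs]
    refine ⟨a, ?_⟩
    rwa [Formula.realize_relabel, Function.comp_id, Sum.elim_swap]
  rw [f.map_formula, Formula.realize_iExs] at hN
  obtain ⟨x, hx⟩ := hN
  rw [Formula.realize_relabel, Sum.elim_swap] at hx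
  exact hφ x hx

theorem realize_iff_eventually_traceFilter [Finite ι] (f : M ↪ₑ[L] N) (a : ι → N) {κ : Type*}
    (φ : L.Formula (ι ⊕ κ)) (b : κ → M) : φ.Realize (Sum.elim a (f ∘ b)) ↔
      ∀ᶠ x in Ultrafilter.of (traceFilter f a), φ.Realize (Sum.elim x b) := by
  have eventually_of_realize (ψ : L.Formula (ι ⊕ κ)) (h : ψ.Realize (Sum.elim a (f ∘ b))) :
      ∀ᶠ x in Ultrafilter.of (traceFilter f a), ψ.Realize (Sum.elim x b) := by
    refine Ultrafilter.of_le (traceFilter f a) ⟨ψ.relabel (Sum.map id b), ?_, fun x hx => ?_⟩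
    · rwa [Formula.realize_relabel, Sum.elim_comp_map, Function.comp_id]
    · rwa [Formula.realize_relabel, Sum.elim_comp_map, Function.id_comp, Function.comp_id] at hx
  refine ⟨eventually_of_realize φ, fun h => by_contra fun hn => ?_⟩
  have hnot := eventually_of_realize φ.not (Formula.realize_not.2 hn)
  obtain ⟨x, hx, hx'⟩ := (h.and hnot).exists
  exact Formula.realize_not.1 hx' hx

/-- The diagonal embedding into an ultrapower. -/
def diagonal (L : FirstOrder.Language.{u, v}) {M : Type w} [L.Structure M] [Nonempty M]
    (u : Ultrafilter ι) : M ↪ₑ[L] (u : Filter ι).Product fun _ => M where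
  toFun m := ((fun _ => m : ι → M) : (u : Filter ι).Product fun _ => M)
  map_formula' _ φ x :=
    (Ultraproduct.realize_formula_cast φ fun g _ => x g).trans Filter.eventually_const

theorem ultrapower_models_completeTheory [Nonempty M] (u : Ultrafilter ι) :
    ((u : Filter ι).Product fun _ => M) ⊨ L.completeTheory M :=
  (diagonal L u).elementarilyEquivalent.theory_model

/-- The complete type of the formulas that hold of almost all members of a family of tuples. -/
noncomputable def averageType [Nonempty M] (u : Ultrafilter ι) {κ : Type*} (x : ι → κ → M) :
    (L.completeTheory M).CompleteType κ :=
  have := ultrapower_models_completeTheory (L := L) (M := M) u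
  (L.completeTheory M).typeOf (M := (u : Filter ι).Product fun _ => M) fun j =>
    ((fun i => x i j : ι → M) : (u : Filter ι).Product fun _ => M)

theorem equivSentence_mem_averageType [Nonempty M] (u : Ultrafilter ι) {κ : Type*}
    (x : ι → κ → M) (φ : L.Formula κ) :
    Formula.equivSentence φ ∈ averageType (L := L) u x ↔ ∀ᶠ i in u, φ.Realize (x i) := by
  have := ultrapower_models_completeTheory (L := L) (M := M) u
  refine Theory.CompleteType.formula_mem_typeOf.trans ?_
  exact Ultraproduct.realize_formula_cast φ fun j i => x i j

end Ultrafilters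

section Types

variable {L : FirstOrder.Language.{0, 0}} {M : Type}

theorem realize_symm_plug {N : Type*} [L.Structure N] [L[[M]].Structure N]
    [(L.lhomWithConstants M).IsExpansionOn N] {n m : ℕ} (φ : L.Formula (Fin n ⊕ Fin m))
    (b : Fin m → M) (x : Fin n → N) :
    (Formula.equivSentence.symm (plug φ b)).Realize x ↔
      φ.Realize (Sum.elim x fun j => (L.con (b j) : N)) := by
  rw [plug, Equiv.symm_apply_apply]
  refine BoundedFormula.realize_subst.trans
    ((LHom.realize_onFormula (L.lhomWithConstants M) φ).trans
      (iff_of_eq (congrArg φ.Realize (funext ?_))))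
  rintro (i | j)
  · rfl
  · exact Term.realize_constants

variable [L.Structure M]

theorem exists_ultrafilter_of_type {n : ℕ} (p : TypeOver L M n) :
    ∃ u : Ultrafilter (Fin n → M), ∀ (m : ℕ) (φ : L.Formula (Fin n ⊕ Fin m)) (b : Fin m → M),
      plug φ b ∈ p ↔ ∀ᶠ x in u, φ.Realize (Sum.elim x b) := by
  obtain ⟨N, a, rfl⟩ := Theory.exists_modelType_is_realized_in _ p
  let _ : L.Structure N := (L.lhomWithConstants M).reduct N
  have : (L.lhomWithConstants M).IsExpansionOn N := LHom.isExpansionOn_reduct _ _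
  let f := ElementaryEmbedding.ofModelsElementaryDiagram L M N
  refine ⟨Ultrafilter.of (traceFilter f a), fun m φ b => ?_⟩
  rw [← Equiv.apply_symm_apply Formula.equivSentence (plug φ b),
    Theory.CompleteType.formula_mem_typeOf, realize_symm_plug]
  exact realize_iff_eventually_traceFilter f a φ b

theorem exists_type_of_ultrafilter [Nonempty M] {ι : Type} (u : Ultrafilter ι) {n : ℕ}
    (x : ι → Fin n → M) : ∃ p : TypeOver L M n, ∀ (m : ℕ) (φ : L.Formula (Fin n ⊕ Fin m))
      (b : Fin m → M), plug φ b ∈ p ↔ ∀ᶠ i in u, φ.Realize (Sum.elim (x i) b) := by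
  refine ⟨averageType (L := L[[M]]) u x, fun m φ b => ?_⟩
  rw [← Equiv.apply_symm_apply Formula.equivSentence (plug φ b), equivSentence_mem_averageType]
  exact Filter.eventually_congr (.of_forall fun i => realize_symm_plug φ b (x i))

theorem infStablyEmbedded_range_iff [Nonempty M] {N : Type} [L.Structure N] (f : M ↪ₑ[L] N)
    (m : ℕ) : InfStablyEmbedded L (Set.range f) m ↔
      ∀ (n k : ℕ), k ≤ m → ∀ (φ : L.Formula (Fin n ⊕ Fin k)) (a : Fin k → N),
        ParamDefinable L fun z : Fin n → M => φ.Realize (Sum.elim (f ∘ z) a) := by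
  refine forall_congr' fun n => forall_congr' fun k => forall_congr' fun _ =>
    forall_congr' fun φ => forall_congr' fun a => ⟨?_, fun h => ?_⟩
  · rintro ⟨l, ψ, b, hb, h⟩
    choose c hc using hb
    obtain rfl : f ∘ c = b := funext hc
    refine ((ParamDefinable.of_formula ψ).subst
      (Sum.elim .inl fun i => .inr (c i))).congr fun z => ?_
    rw [h (f ∘ z) fun i => ⟨z i, rfl⟩, ← Sum.comp_elim, f.map_formula]
    refine iff_of_eq (congrArg ψ.Realize (funext fun o => ?_))
    cases o <;> rfl
  · obtain ⟨l, ψ, s, hψ⟩ := (h.comp (Sum.inl : Fin n → Fin n ⊕ Empty)).exists_formula_sum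
    refine ⟨l, ψ, fun i => f (Sum.elim Empty.elim id (s i)), fun j => ⟨_, rfl⟩, fun x hx => ?_⟩
    choose z hz using hx
    obtain rfl : f ∘ z = x := funext hz
    refine (hψ z Empty.elim).trans ?_
    rw [← f.map_formula, Sum.comp_elim]
    rfl

end Types

section PolyBounded

universe u v u' v'

/-- The number of traces `{t | Q x (b t)}` that the objects `x` leave on a family `b` of `k`
parameters is bounded by a polynomial in `k`. The shape `(k + 2) ^ d` makes these bounds closed
under products and absorbs constant factors. -/
def PolyBounded {X : Type u} {Y : Type v} (Q : X → Y → Prop) : Prop :=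
  ∃ d : ℕ, ∀ (T : Type) [Fintype T] (b : T → Y),
    (Set.range fun x t => Q x (b t)).ncard ≤ (Fintype.card T + 2) ^ d

/-- The relation `Q` shatters some set of `d` parameters: each of its subsets is the trace of an
object. -/
def Shatters {X : Type u} {Y : Type v} (Q : X → Y → Prop) (d : ℕ) : Prop :=
  ∃ (a : Fin d → Y) (b : Set (Fin d) → X), ∀ t s, Q (b s) (a t) ↔ t ∈ s

variable {X : Type u} {Y : Type v} {X' : Type u'} {Y' : Type v'}

theorem exists_pow_lt_two_pow (d : ℕ) : ∃ k : ℕ, (k + 2) ^ d < 2 ^ k := by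
  have hlim := tendsto_pow_const_div_const_pow_of_one_lt d (r := (2 : ℝ)) (by norm_num)
  obtain ⟨N, hN⟩ := (hlim.eventually (gt_mem_nhds (show (0 : ℝ) < 1 / 4 by
    norm_num))).exists_forall_of_atTop
  have hlt := hN (N + 2) (by omega)
  rw [div_lt_iff₀ (by positivity), pow_add] at hlt
  have hlt' : ((N + 2 : ℕ) : ℝ) ^ d < 2 ^ N := by linarith
  exact ⟨N, by exact_mod_cast hlt'⟩

theorem ncard_range_le_prod {I : Type} [Fintype I] {B : Type*} {A : I → Type*}
    [∀ i, Finite (A i)] (f : X → B) (g : ∀ i, X → A i)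
    (h : ∀ x x', (∀ i, g i x = g i x') → f x = f x') :
    (Set.range f).ncard ≤ ∏ i, (Set.range (g i)).ncard := by
  choose x hx using fun y : Set.range f => y.2
  have hinj : Function.Injective fun (y : Set.range f) (i : I) =>
      (⟨g i (x y), x y, rfl⟩ : Set.range (g i)) := fun y y' e => by
    refine Subtype.ext ?_
    rw [← hx y, ← hx y']
    exact h _ _ fun i => congrArg Subtype.val (congrFun e i)
  have hcard := Nat.card_le_card_of_injective _ hinj
  rwa [Nat.card_pi] at hcard

namespace PolyBounded

variable {Q Q' : X → Y → Prop}

theorem comp (hQ : PolyBounded Q) (f : X' → X) (g : Y' → Y) :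
    PolyBounded fun x y => Q (f x) (g y) := by
  obtain ⟨d, hd⟩ := hQ
  refine ⟨d, fun T _ b => (Set.ncard_le_ncard ?_ (Set.toFinite _)).trans (hd T fun t => g (b t))⟩
  rintro _ ⟨x, rfl⟩
  exact ⟨f x, rfl⟩

theorem congr (hQ : PolyBounded Q) (h : ∀ x y, Q x y ↔ Q' x y) : PolyBounded Q' := by
  rwa [← funext fun x => funext fun y => propext (h x y)]

theorem of_subsingleton [Subsingleton X] (Q : X → Y → Prop) : PolyBounded Q :=
  ⟨0, fun _ _ _ => by
    rw [pow_zero]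
    exact Set.ncard_le_one_iff_subsingleton.2 (Set.subsingleton_range _)⟩

theorem of_determined {I : Type} [Finite I] {P : I → X → Y → Prop} (hP : ∀ i, PolyBounded (P i))
    (h : ∀ x x' y, (∀ i, P i x y ↔ P i x' y) → (Q x y ↔ Q x' y)) : PolyBounded Q := by
  have := Fintype.ofFinite I
  choose d hd using hP
  refine ⟨∑ i, d i, fun T _ b => ?_⟩
  refine (ncard_range_le_prod _ (fun i x t => P i x (b t)) fun x x' e => ?_).trans ?_
  · exact funext fun t => propext (h _ _ _ fun i => iff_of_eq (congrFun (e i) t))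
  · rw [← Finset.prod_pow_eq_pow_sum]
    exact Finset.prod_le_prod' fun i _ => hd i T b

/-- There are only polynomially many pairs `(i, o)`, and each of them contributes polynomially many
traces. -/
theorem of_object_cover {I : Type} [Finite I] (c : ℕ) {W : I → Type*}
    {P : ∀ i, W i → (Fin c → Y) × Y → Prop} (hP : ∀ i, PolyBounded (P i))
    (h : ∀ (T : Type) [Fintype T] [Nonempty T] (b : T → Y) (x : X), ∃ (i : I) (w : W i)
      (o : Fin c → T), ∀ t, Q x (b t) ↔ P i w (b ∘ o, b t)) : PolyBounded Q := by
  classical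
  have := Fintype.ofFinite I
  choose d hd using hP
  refine ⟨Fintype.card I + c + ∑ i, d i, fun T _ b => ?_⟩
  rcases isEmpty_or_nonempty T with hT | hT
  · exact (Set.ncard_le_one_iff_subsingleton.2 Set.subsingleton_of_subsingleton).trans
      (Nat.one_le_pow _ _ (by omega))
  let traces (j : I × (Fin c → T)) : Set (T → Prop) :=
    Set.range fun w t => P j.1 w (b ∘ j.2, b t)
  have hcover : (Set.range fun x t => Q x (b t)) ⊆ ⋃ j, traces j := by
    rintro _ ⟨x, rfl⟩
    obtain ⟨i, w, o, hw⟩ := h T b x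
    exact Set.mem_iUnion.2 ⟨(i, o), w, funext fun t => propext (hw t).symm⟩
  have htraces (j) : (traces j).ncard ≤ (Fintype.card T + 2) ^ ∑ i, d i :=
    (hd j.1 T _).trans (Nat.pow_le_pow_right (by omega)
      (Finset.single_le_sum (f := d) (fun _ _ => Nat.zero_le _) (Finset.mem_univ j.1)))
  have hkinds : Fintype.card (I × (Fin c → T)) ≤
      (Fintype.card T + 2) ^ (Fintype.card I + c) := by
    rw [Fintype.card_prod, Fintype.card_fun, Fintype.card_fin, pow_add]
    refine Nat.mul_le_mul ?_ (Nat.pow_le_pow_left (by omega) _)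
    exact Nat.lt_two_pow_self.le.trans (Nat.pow_le_pow_left (by omega) _)
  calc (Set.range fun x t => Q x (b t)).ncard
      ≤ (⋃ j, traces j).ncard := Set.ncard_le_ncard hcover (Set.toFinite _)
    _ ≤ ∑ j, (traces j).ncard := Set.ncard_iUnion_le_of_fintype _
    _ ≤ Fintype.card (I × (Fin c → T)) * (Fintype.card T + 2) ^ ∑ i, d i :=
      Finset.sum_le_card_nsmul _ _ _ fun j _ => htraces j
    _ ≤ (Fintype.card T + 2) ^ (Fintype.card I + c) * (Fintype.card T + 2) ^ ∑ i, d i :=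
      Nat.mul_le_mul_right _ hkinds
    _ = (Fintype.card T + 2) ^ (Fintype.card I + c + ∑ i, d i) := (pow_add _ _ _).symm

theorem le {A : Type*} [LinearOrder A] : PolyBounded fun n h : A => n ≤ h := by
  refine of_object_cover (I := Bool) (W := fun _ => Unit)
    (P := fun i _ z => i = true ∧ z.1 0 ≤ z.2) 1 (fun _ => of_subsingleton _) fun T _ _ b n => ?_
  by_cases hn : ∃ t, n ≤ b t
  · obtain ⟨t, ht⟩ := hn
    obtain ⟨t₀, ht₀, hmin⟩ := {t | n ≤ b t}.toFinite.exists_minimalFor b _ ⟨t, ht⟩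
    refine ⟨true, (), fun _ => t₀, fun t => ⟨fun h => ⟨rfl, ?_⟩, fun h => ht₀.trans h.2⟩⟩
    exact (le_total (b t₀) (b t)).elim id (hmin h)
  · exact ⟨false, (), fun _ => Classical.arbitrary T, fun t => by simpa using fun h => hn ⟨t, h⟩⟩

theorem exists_not_shatters (hQ : PolyBounded Q) : ∃ d, ¬ Shatters Q d := by
  obtain ⟨d, hd⟩ := hQ
  obtain ⟨k, hk⟩ := exists_pow_lt_two_pow d
  refine ⟨k, fun ⟨a, b, hab⟩ => hk.not_ge ?_⟩
  have huniv : (Set.range fun x t => Q x (a t)) = Set.univ := Set.eq_univ_of_forall fun f =>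
    ⟨b {t | f t}, funext fun t => propext (hab t {t | f t})⟩
  have hcard := hd (Fin k) a
  rwa [huniv, Set.ncard_univ, Nat.card_eq_fintype_card, Fintype.card_fun, Fintype.card_prop,
    Fintype.card_fin] at hcard

end PolyBounded

theorem exists_shatters_card_eq_of_le_vcDim {T : Type*} [DecidableEq T] {𝒜 : Finset (Finset T)}
    {d : ℕ} (hd : 0 < d) (h : d ≤ 𝒜.vcDim) : ∃ s : Finset T, s.card = d ∧ 𝒜.Shatters s := by
  obtain ⟨s, hs, hsd⟩ : ∃ s ∈ 𝒜.shatterer, d ≤ s.card := by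
    by_contra! hc
    exact h.not_gt ((Finset.sup_lt_iff hd).2 hc)
  obtain ⟨s', hs's, hs'⟩ := Finset.exists_subset_card_eq hsd
  exact ⟨s', hs', (Finset.mem_shatterer.1 hs).mono_right hs's⟩

theorem card_le_pow_of_vcDim_lt {T : Type*} [Fintype T] [DecidableEq T] {𝒜 : Finset (Finset T)}
    {d : ℕ} (h : 𝒜.vcDim < d) : 𝒜.card ≤ (Fintype.card T + 2) ^ (d + d) := by
  have hchoose (k) (hk : k ∈ Finset.Iic 𝒜.vcDim) :
      (Fintype.card T).choose k ≤ (Fintype.card T + 2) ^ d :=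
    (Nat.choose_le_pow _ _).trans ((Nat.pow_le_pow_left (by omega) k).trans
      (Nat.pow_le_pow_right (by omega) ((Finset.mem_Iic.1 hk).trans h.le)))
  have hvcDim : 𝒜.vcDim + 1 ≤ (Fintype.card T + 2) ^ d :=
    (Nat.succ_le_of_lt h).trans
      (Nat.lt_two_pow_self.le.trans (Nat.pow_le_pow_left (Nat.le_add_left _ _) _))
  calc 𝒜.card
      ≤ 𝒜.shatterer.card := Finset.card_le_card_shatterer 𝒜
    _ ≤ ∑ k ∈ Finset.Iic 𝒜.vcDim, (Fintype.card T).choose k :=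
      Finset.card_shatterer_le_sum_vcDim
    _ ≤ (𝒜.vcDim + 1) * (Fintype.card T + 2) ^ d := by
      rw [← Nat.card_Iic, ← smul_eq_mul]
      exact Finset.sum_le_card_nsmul _ _ _ hchoose
    _ ≤ (Fintype.card T + 2) ^ (d + d) := by
      rw [pow_add]
      exact Nat.mul_le_mul_right _ hvcDim

open Classical in
theorem PolyBounded.of_not_shatters {Q : X → Y → Prop} {d : ℕ} (h : ¬ Shatters Q d) :
    PolyBounded Q := by
  rcases isEmpty_or_nonempty X with hX | ⟨⟨x₀⟩⟩
  · exact PolyBounded.of_subsingleton Q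
  have hd : 0 < d := Nat.pos_iff_ne_zero.2 fun hd => h <| by
    subst hd
    exact ⟨Fin.elim0, fun _ => x₀, fun t => t.elim0⟩
  refine ⟨d + d, fun T _ b => ?_⟩
  let trace (x : X) : Finset T := {t | Q x (b t)}
  have hcard : (Set.range fun x t => Q x (b t)).ncard =
      (Set.range trace).toFinite.toFinset.card := by
    have himage : (Set.range fun x t => Q x (b t)) =
        (fun (s : Finset T) t => t ∈ s) '' Set.range trace := by
      rw [← Set.range_comp]
      congr! 3 with x t
      simp only [Function.comp_apply, trace, Finset.mem_filter_univ]
    rw [himage, Set.ncard_image_of_injective, Set.ncard_eq_toFinset_card]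
    exact fun s s' e => Finset.ext fun t => iff_of_eq (congrFun e t)
  rw [hcard]
  refine card_le_pow_of_vcDim_lt (lt_of_not_ge fun hle => h ?_)
  obtain ⟨s, hs, hshatters⟩ := exists_shatters_card_eq_of_le_vcDim hd hle
  let e := s.equivFinOfCardEq hs
  have htrace (S : Set (Fin d)) : ∃ x, ∀ t, Q x (b (e.symm t)) ↔ t ∈ S := by
    obtain ⟨u, hu, hu'⟩ := hshatters (t := {t ∈ s | ∃ h : t ∈ s, e ⟨t, h⟩ ∈ S})
      (Finset.filter_subset _ _)
    obtain ⟨x, rfl⟩ : ∃ x, trace x = u := by simpa using hu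
    refine ⟨x, fun t => ?_⟩
    simpa [trace] using Finset.ext_iff.1 hu' (e.symm t)
  choose x hx using htrace
  exact ⟨_, x, fun t S => hx S t⟩

theorem Shatters.of_flip {Q : X → Y → Prop} {d : ℕ}
    (h : Shatters (flip Q) (Fintype.card (Set (Fin d)))) : Shatters Q d := by
  obtain ⟨a, b, hab⟩ := h
  let e := Fintype.equivFin (Set (Fin d))
  refine ⟨fun t => b {j | t ∈ e.symm j}, fun s => a (e s), fun t s => (hab _ _).trans ?_⟩
  rw [Set.mem_ofPred_eq, Equiv.symm_apply_apply]

theorem PolyBounded.flip {Q : X → Y → Prop} (h : PolyBounded Q) : PolyBounded (flip Q) := by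
  obtain ⟨d, hd⟩ := h.exists_not_shatters
  exact .of_not_shatters fun hflip => hd (.of_flip hflip)

end PolyBounded

section NIP

open Classical in
/-- The sentence saying that the relation defined by `φ` shatters a set of `k` parameters. -/
noncomputable def shatterSentence {L : FirstOrder.Language} {α β : Type} [Finite α] [Finite β]
    (φ : L.Formula (α ⊕ β)) (k : ℕ) : L.Sentence :=
  ((Formula.iInf fun p : Fin k × Set (Fin k) =>
    let ψ := φ.relabel (Sum.map (fun i => (p.1, i)) fun j => (p.2, j))
    if p.1 ∈ p.2 then ψ else ψ.not).relabel Sum.inr).iExs ((Fin k × α) ⊕ (Set (Fin k) × β))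

theorem realize_shatterSentence {L : FirstOrder.Language} {K : Type*} [L.Structure K]
    {α β : Type} [Finite α] [Finite β] (φ : L.Formula (α ⊕ β)) (k : ℕ) :
    K ⊨ shatterSentence φ k ↔
      Shatters (fun (b : β → K) (a : α → K) => φ.Realize (Sum.elim a b)) k := by
  classical
  have hliteral (p : Fin k × Set (Fin k)) (ψ : L.Formula ((Fin k × α) ⊕ (Set (Fin k) × β)))
      (v : (Fin k × α) ⊕ (Set (Fin k) × β) → K) :
      (if p.1 ∈ p.2 then ψ else ψ.not).Realize v ↔ (ψ.Realize v ↔ p.1 ∈ p.2) := by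
    by_cases hp : p.1 ∈ p.2
    · simp only [hp, if_true, iff_true]
    · simp only [hp, if_false, Formula.realize_not, iff_false]
  have hsplit (p : Fin k × Set (Fin k)) (v : (Fin k × α) ⊕ (Set (Fin k) × β) → K) :
      v ∘ Sum.map (fun i => (p.1, i)) (fun j => (p.2, j)) =
        Sum.elim (fun i => v (.inl (p.1, i))) fun j => v (.inr (p.2, j)) := by
    funext o
    cases o <;> rfl
  simp only [shatterSentence, Sentence.Realize, Formula.realize_iExs, Formula.realize_relabel,
    Formula.realize_iInf, Sum.elim_comp_inr, hliteral, hsplit]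
  constructor
  · rintro ⟨v, hv⟩
    exact ⟨fun t i => v (.inl (t, i)), fun s j => v (.inr (s, j)), fun t s => hv (t, s)⟩
  · rintro ⟨a, b, hab⟩
    exact ⟨Sum.elim (fun q => a q.1 q.2) fun q => b q.1 q.2, fun p => hab p.1 p.2⟩

variable {L : FirstOrder.Language.{0, 0}} {M : Type} [L.Structure M]

theorem isNIP_of_polyBounded
    (h : ∀ (n m : ℕ) (φ : L.Formula (Fin n ⊕ Fin m)),
      PolyBounded fun (b : Fin m → M) (a : Fin n → M) => φ.Realize (Sum.elim a b)) :
    IsNIP (L.completeTheory M) := by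
  rintro n m φ N _ _ hN ⟨a, b, hab⟩
  obtain ⟨k, hk⟩ := (h n m φ).exists_not_shatters
  have hσN : N ⊨ shatterSentence φ k := (realize_shatterSentence φ k).2
    ⟨fun t => a t, fun s => b (Fin.val '' s), fun t s => by simp [hab, Fin.val_inj]⟩
  have hσM : M ⊨ (shatterSentence φ k).not := fun hσ => hk ((realize_shatterSentence φ k).1 hσ)
  have hσN' : N ⊨ (shatterSentence φ k).not := hN.realize_of_mem _ hσM
  exact hσN' hσN

theorem not_isNIP_of_forall_shatters [Nonempty M] {n m : ℕ} (φ : L.Formula (Fin n ⊕ Fin m))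
    (h : ∀ d, Shatters (fun (b : Fin m → M) (a : Fin n → M) => φ.Realize (Sum.elim a b)) d) :
    ¬ IsNIP (L.completeTheory M) := by
  classical
  choose a b hab using h
  obtain ⟨x₀⟩ := ‹Nonempty M›
  let u : Ultrafilter ℕ := Filter.hyperfilter ℕ
  let A (t : ℕ) (i : Fin n) (d : ℕ) : M := if ht : t < d then a d ⟨t, ht⟩ i else x₀
  let B (s : Set ℕ) (j : Fin m) (d : ℕ) : M := b d {t | t.1 ∈ s} j
  let toProduct (x : ℕ → M) : (u : Filter ℕ).Product fun _ => M := x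
  have : Nonempty ((u : Filter ℕ).Product fun _ => M) := ⟨toProduct fun _ => x₀⟩
  refine fun hNIP => hNIP n m φ _ (ultrapower_models_completeTheory u)
    ⟨fun t i => toProduct (A t i), fun s j => toProduct (B s j), fun t s => ?_⟩
  have hpattern : ∀ᶠ d in (u : Filter ℕ),
      (φ.Realize fun g => Sum.elim (A t) (B s) g d) ↔ t ∈ s := by
    have hlt : ∀ᶠ d in (u : Filter ℕ), t < d :=
      Filter.Tendsto.eventually_gt_atTop (Nat.hyperfilter_le_atTop) t
    filter_upwards [hlt] with d hd
    refine Iff.trans (iff_of_eq (congrArg φ.Realize (funext ?_))) (hab d ⟨t, hd⟩ {t | t.1 ∈ s})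
    rintro (i | j)
    · simp only [Sum.elim_inl, A, dif_pos hd]
    · rfl
  have hreal := (Ultraproduct.realize_formula_cast (u := u) (M := fun _ => M) φ
    (Sum.elim (A t) (B s))).trans ((Filter.eventually_congr hpattern).trans Filter.eventually_const)
  refine (iff_of_eq (congrArg φ.Realize (funext ?_))).trans hreal
  rintro (i | j) <;> rfl

theorem IsNIP.polyBounded [Nonempty M] (h : IsNIP (L.completeTheory M)) {n m : ℕ}
    (φ : L.Formula (Fin n ⊕ Fin m)) :
    PolyBounded fun (b : Fin m → M) (a : Fin n → M) => φ.Realize (Sum.elim a b) :=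
  by_contra fun hφ => not_isNIP_of_forall_shatters φ
    (fun _ => by_contra fun hd => hφ (.of_not_shatters hd)) h

theorem IsNIP.polyBounded_of_paramDefinable [Nonempty M] (h : IsNIP (L.completeTheory M))
    {α α' : Type} {Q : (α ⊕ α' → M) → Prop} (hQ : ParamDefinable L Q) :
    PolyBounded fun (x : α → M) (y : α' → M) => Q (Sum.elim x y) := by
  classical
  obtain ⟨n, g, ψ, hψ⟩ := hQ.exists_formula_fin
  obtain ⟨x₀⟩ := ‹Nonempty M›
  have hbound := h.polyBounded (ψ.relabel fun i =>
    if ∃ a, g i = .inl (.inl a) then (Sum.inr i : Fin n ⊕ Fin n) else Sum.inl i)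
  refine (hbound.comp
    (fun (x : α → M) i => Sum.elim (Sum.elim x fun _ : α' => x₀) id (g i))
    (fun (y : α' → M) i => Sum.elim (Sum.elim (fun _ : α => x₀) y) id (g i))).congr fun x y => ?_
  rw [hψ, Formula.realize_relabel]
  refine iff_of_eq (congrArg _ (funext fun i => ?_))
  rcases hg : g i with (a | a) | a <;> simp [hg]

end NIP

section Action

variable {L : FirstOrder.Language.{0, 0}} {M : Type} [L.Structure M] {E : L.Relations 2}

theorem Layering.nonempty_type (D : Layering M E) : Nonempty M :=
  (D.nonempty 0).to_type

theorem Layering.lt_size (D : Layering M E) (k : ℕ) : k < D.size k := by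
  induction k with
  | zero => exact (Set.ncard_pos (D.finite 0)).2 (D.nonempty 0)
  | succ k ih => exact (Nat.succ_le_of_lt ih).trans_lt (D.strictMono (Nat.lt_succ_self k))

/-- The reduced words over the `k`-th class, that is, the elements of the free product of copies of
`ℤ/2` indexed by this class. -/
def Layering.IsReduced (D : Layering M E) (k : ℕ) (l : List M) : Prop :=
  l.IsChain (· ≠ ·) ∧ ∀ c ∈ l, D.lev c = k

namespace Layering.IsReduced

variable {D : Layering M E} {k : ℕ} {l l' : List M} {c : M}

theorem nil : D.IsReduced k [] :=
  ⟨.nil, by simp⟩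

theorem of_isInfix (h : D.IsReduced k l) (hl : l' <:+: l) : D.IsReduced k l' := by
  refine ⟨?_, fun c hc => h.2 c (hl.subset hc)⟩
  obtain ⟨s, t, rfl⟩ := hl
  exact h.1.left_of_append.right_of_append

theorem of_cons (h : D.IsReduced k (c :: l)) : D.IsReduced k l :=
  h.of_isInfix (List.suffix_cons c l).isInfix

theorem cons (h : D.IsReduced k l) (hc : D.lev c = k) (hl : l.head? ≠ some c) :
    D.IsReduced k (c :: l) := by
  refine ⟨List.isChain_cons.2 ⟨?_, h.1⟩, List.forall_mem_cons.2 ⟨hc, h.2⟩⟩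
  rintro d hd rfl
  exact hl hd

theorem reverse_append (h : D.IsReduced k l) (h' : D.IsReduced k l')
    (hl : l'.head? ≠ l.head?) : D.IsReduced k (l.reverse ++ l') := by
  refine ⟨List.isChain_append.2 ⟨?_, h'.1, ?_⟩, fun c hc => ?_⟩
  · simpa only [List.isChain_reverse, ne_comm] using h.1
  · rintro c hc d hd rfl
    rw [List.getLast?_reverse] at hc
    exact hl (hd.trans hc.symm)
  · rcases List.mem_append.1 hc with hc | hc
    exacts [h.2 c (List.mem_reverse.1 hc), h'.2 c hc]

end Layering.IsReduced

namespace Layering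

variable (D : Layering M E) (k : ℕ)

open Classical in
/-- The reduced form of the word `c :: r`, for a reduced word `r` over the `k`-th class. Letters
outside of this class are dropped. -/
noncomputable def reduceCons (c : M) (r : List M) : List M :=
  if D.lev c = k then if r.head? = some c then r.tail else c :: r else r

/-- The reduced word over the `k`-th class that acts on the `k`-th piece of a coding in the same
way as a given word. -/
noncomputable def reduce (l : List M) : List M :=
  l.foldr (D.reduceCons k) []

theorem reduce_nil : D.reduce k [] = [] := rfl

theorem reduce_cons (c : M) (l : List M) :
    D.reduce k (c :: l) = D.reduceCons k c (D.reduce k l) := rfl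

variable {k} in
theorem reduceCons_eq_iff {c : M} {r s : List M} : D.reduceCons k c r = s ↔
    D.lev c ≠ k ∧ r = s ∨ D.lev c = k ∧ (r = c :: s ∨ r.head? ≠ some c ∧ c :: r = s) := by
  unfold reduceCons
  split_ifs with hc hhead
  · obtain ⟨r, rfl⟩ := List.head?_eq_some_iff.1 hhead
    simp [hc]
  · have hne : r ≠ c :: s := by
      rintro rfl
      exact hhead rfl
    simp [hc, hhead, hne]
  · simp [hc]

variable {k} in
theorem isReduced_reduceCons (c : M) {r : List M} (h : D.IsReduced k r) :
    D.IsReduced k (D.reduceCons k c r) := by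
  unfold reduceCons
  split_ifs with hc hhead
  · exact h.of_isInfix (List.tail_suffix _).isInfix
  · exact h.cons hc hhead
  · exact h

variable {k} in
theorem reduceCons_reduceCons (c : M) {r : List M} (h : D.IsReduced k r) :
    D.reduceCons k c (D.reduceCons k c r) = r := by
  by_cases hc : D.lev c = k
  · by_cases hhead : r.head? = some c
    · obtain ⟨r, rfl⟩ := List.head?_eq_some_iff.1 hhead
      have hr : r.head? ≠ some c := fun hr => (List.isChain_cons.1 h.1).1 c hr rfl
      simp [reduceCons, hc, hr]
    · simp [reduceCons, hc, hhead]
  · simp [reduceCons, hc]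

theorem isReduced_reduce (l : List M) : D.IsReduced k (D.reduce k l) := by
  induction l with
  | nil => exact .nil
  | cons c l ih => exact D.isReduced_reduceCons c ih

theorem length_reduce_le (l : List M) : (D.reduce k l).length ≤ l.length := by
  induction l with
  | nil => exact le_rfl
  | cons c l ih =>
    rw [reduce_cons, reduceCons, List.length_cons]
    split_ifs
    · rw [List.length_tail]
      lia
    · exact Nat.succ_le_succ ih
    · exact ih.trans (Nat.le_succ _)

end Layering

theorem Layering.exists_isReduced_length_eq (D : Layering M E) {k : ℕ} (hk : 0 < k) (n : ℕ) :
    ∃ l, D.IsReduced k l ∧ l.length = n := by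
  have hnontrivial : {a : M | D.lev a = k}.Nontrivial :=
    (Set.one_lt_ncard_iff_nontrivial_and_finite.1 ((Nat.succ_le_of_lt hk).trans_lt (D.lt_size k))).1
  induction n with
  | zero => exact ⟨[], .nil, rfl⟩
  | succ n ih =>
    obtain ⟨l, hl, rfl⟩ := ih
    obtain ⟨c, hc, hne⟩ : ∃ c, D.lev c = k ∧ l.head? ≠ some c := by
      cases l with
      | nil => exact ⟨_, hnontrivial.nonempty.some_mem, by simp⟩
      | cons d l =>
        obtain ⟨c, hc, hcd⟩ := hnontrivial.exists_ne d
        exact ⟨c, hc, by simpa using hcd.symm⟩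
    exact ⟨c :: l, hl.cons hc hne, rfl⟩

namespace Coding

variable {D : Layering M E} (C : Coding D)

theorem finite_lev_lt (N : ℕ) : {v : C.V | C.lev v < N}.Finite :=
  ((Set.finite_lt_nat N).biUnion fun k _ => C.finite k).subset fun v hv =>
    Set.mem_biUnion (show C.lev v ∈ {k | k < N} from hv) rfl

variable {C}

theorem color_symm {u v : C.V} (h : C.S.Adj u v) : C.color h.symm = C.color h := by
  unfold color
  congr 2
  exact Subtype.ext Sym2.eq_swap

theorem lev_color {u v : C.V} (h : C.S.Adj u v) : D.lev (C.color h) = C.lev u :=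
  C.lev_π ⟨s(u, v), h⟩ u (Sym2.mem_mk_left u v)

theorem existsUnique_neighbor {c : M} {v : C.V} (h : D.lev c = C.lev v) :
    ∃! w, ∃ h : C.S.Adj v w, C.color h = c := by
  obtain ⟨⟨e, he⟩, ⟨hv, hq⟩, huniq⟩ := C.existsUnique_edge v (C.π.symm c) (by simpa using h)
  obtain ⟨w, rfl⟩ := Sym2.mem_iff_exists.1 hv
  refine ⟨w, ⟨he, (Equiv.eq_symm_apply _).1 hq⟩, ?_⟩
  rintro w' ⟨hw', hc⟩
  have hedge := huniq ⟨s(v, w'), hw'⟩ ⟨Sym2.mem_mk_left _ _, (Equiv.eq_symm_apply _).2 hc⟩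
  exact Sym2.congr_right.1 (congrArg Subtype.val hedge)

variable (C)

open Classical in
/-- The neighbour of `v` along the edge of colour `c`; the vertex `v` itself if its piece has no
edges of this colour. -/
noncomputable def act (c : M) (v : C.V) : C.V :=
  if h : D.lev c = C.lev v then (existsUnique_neighbor h).choose else v

theorem act_of_ne {c : M} {v : C.V} (h : D.lev c ≠ C.lev v) : C.act c v = v :=
  dif_neg h

theorem act_eq_iff {c : M} {v w : C.V} (h : D.lev c = C.lev v) :
    C.act c v = w ↔ ∃ h : C.S.Adj v w, C.color h = c := by
  have hspec := (existsUnique_neighbor h).choose_spec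
  rw [act, dif_pos h]
  constructor
  · rintro rfl
    exact hspec.1
  · exact fun hw => (hspec.2 w hw).symm

theorem adj_act {c : M} {v : C.V} (h : D.lev c = C.lev v) : C.S.Adj v (C.act c v) :=
  ((C.act_eq_iff h).1 rfl).1

theorem color_adj_act {c : M} {v : C.V} (h : D.lev c = C.lev v) : C.color (C.adj_act h) = c :=
  ((C.act_eq_iff h).1 rfl).2

theorem lev_act (c : M) (v : C.V) : C.lev (C.act c v) = C.lev v := by
  by_cases h : D.lev c = C.lev v
  · exact (C.lev_eq_of_adj _ _ (C.adj_act h)).symm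
  · rw [C.act_of_ne h]

theorem act_act (c : M) (v : C.V) : C.act c (C.act c v) = v := by
  by_cases h : D.lev c = C.lev v
  · exact (C.act_eq_iff (h.trans (C.lev_act c v).symm)).2
      ⟨(C.adj_act h).symm, (color_symm (C.adj_act h)).trans (C.color_adj_act h)⟩
  · rw [C.act_of_ne h, C.act_of_ne h]

theorem act_injective (c : M) : Function.Injective (C.act c) :=
  Function.Involutive.injective (C.act_act c)

theorem act_eq_comm {c : M} {v w : C.V} : C.act c v = w ↔ v = C.act c w :=
  (Function.Involutive.eq_iff (C.act_act c))

theorem eq_of_act_eq {c d : M} {v : C.V} (hc : D.lev c = C.lev v) (hd : D.lev d = C.lev v)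
    (h : C.act c v = C.act d v) : c = d := by
  obtain ⟨_, hcolor⟩ := (C.act_eq_iff hc).1 h
  exact hcolor.symm.trans (C.color_adj_act hd)

/-- The action of words of colours, the last letter acting first. -/
noncomputable def actL (l : List M) (v : C.V) : C.V :=
  l.foldr C.act v

@[simp]
theorem actL_nil (v : C.V) : C.actL [] v = v := rfl

@[simp]
theorem actL_cons (c : M) (l : List M) (v : C.V) :
    C.actL (c :: l) v = C.act c (C.actL l v) := rfl

theorem actL_append (l l' : List M) (v : C.V) : C.actL (l ++ l') v = C.actL l (C.actL l' v) :=
  List.foldr_append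

theorem lev_actL (l : List M) (v : C.V) : C.lev (C.actL l v) = C.lev v := by
  induction l with
  | nil => rfl
  | cons c l ih => rw [actL_cons, lev_act, ih]

theorem actL_eq_comm {l : List M} {v w : C.V} : C.actL l v = w ↔ v = C.actL l.reverse w := by
  induction l generalizing v w with
  | nil => rfl
  | cons c l ih =>
    rw [actL_cons, act_eq_comm, ih, List.reverse_cons, actL_append, actL_cons, actL_nil]

theorem exists_walk_actL (l : List M) (v : C.V) (hl : ∀ c ∈ l, D.lev c = C.lev v) :
    ∃ p : C.S.Walk (C.actL l v) v, p.length = l.length ∧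
      p.support = l.tails.map fun t => C.actL t v := by
  induction l with
  | nil => exact ⟨.nil, rfl, rfl⟩
  | cons c l ih =>
    obtain ⟨hc, hl⟩ := List.forall_mem_cons.1 hl
    obtain ⟨p, hlength, hsupport⟩ := ih hl
    refine ⟨.cons (C.adj_act (hc.trans (C.lev_actL l v).symm)).symm p, by simp [hlength], ?_⟩
    rw [List.tails_cons, List.map_cons, ← hsupport]
    exact SimpleGraph.Walk.support_cons _ _

/-- Otherwise the suffixes of the word trace out a short cycle through `v`. -/
theorem actL_cons_ne_of_nodup {c : M} {l : List M} {v : C.V}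
    (hred : D.IsReduced (C.lev v) (c :: l)) (hlen : l.length < D.size (C.lev v))
    (hnodup : (l.tails.map fun t => C.actL t v).Nodup) : C.actL (c :: l) v ≠ v := by
  intro hfix
  rw [actL_cons, act_eq_comm] at hfix
  obtain ⟨hc, hl⟩ := List.forall_mem_cons.1 hred.2
  obtain ⟨p, hp, hsupport⟩ := C.exists_walk_actL l v hl
  have hpath : p.IsPath := (SimpleGraph.Walk.isPath_def p).2 (hsupport ▸ hnodup)
  have hadj : C.S.Adj v (C.actL l v) := hfix ▸ C.adj_act hc
  have hcycle : (SimpleGraph.Walk.cons hadj p).IsCycle := by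
    refine SimpleGraph.Walk.cons_isCycle_iff p hadj |>.2 ⟨hpath, fun hedge => ?_⟩
    have hone := hpath.length_eq_one_of_mem_edges (by rwa [Sym2.eq_swap])
    obtain ⟨d, rfl⟩ := List.length_eq_one_iff.1 (hp ▸ hone)
    exact List.isChain_pair.1 hred.1 (C.eq_of_act_eq hc (hl d (by simp)) hfix.symm)
  have hlong := C.no_short_cycle v _ hcycle
  rw [SimpleGraph.Walk.length_cons, hp] at hlong
  exact (Nat.succ_le_of_lt hlen).not_gt hlong

theorem nodup_actL_tails {l : List M} {v : C.V} (hred : D.IsReduced (C.lev v) l)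
    (hlen : l.length ≤ D.size (C.lev v)) : (l.tails.map fun t => C.actL t v).Nodup := by
  induction hn : l.length using Nat.strong_induction_on generalizing l v with
  | _ n ih =>
  subst hn
  cases l with
  | nil => simp
  | cons c l =>
    rw [List.tails_cons, List.map_cons, List.nodup_cons]
    rw [List.length_cons] at hlen ih
    refine ⟨fun hmem => ?_, ih l.length (by lia) hred.of_cons (by lia) rfl⟩
    obtain ⟨t, ht, heq⟩ := List.mem_map.1 hmem
    obtain ⟨s, rfl⟩ := (List.mem_tails _ _).1 ht
    rw [← List.cons_append, actL_append] at heq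
    have hred' : D.IsReduced (C.lev (C.actL t v)) (c :: s) := by
      rw [lev_actL]
      exact hred.of_isInfix (List.prefix_append (c :: s) t).isInfix
    rw [List.length_append] at hlen ih
    have hlen' : s.length < D.size (C.lev (C.actL t v)) := by
      rw [lev_actL]
      lia
    exact C.actL_cons_ne_of_nodup hred' hlen'
      (ih s.length (by lia) hred'.of_cons hlen'.le rfl) heq.symm

theorem actL_ne_of_isReduced {l : List M} {v : C.V} (hred : D.IsReduced (C.lev v) l) (hne : l ≠ [])
    (hlen : l.length ≤ D.size (C.lev v)) : C.actL l v ≠ v := by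
  obtain ⟨c, l, rfl⟩ := List.exists_cons_of_ne_nil hne
  exact C.actL_cons_ne_of_nodup hred hlen (C.nodup_actL_tails hred.of_cons (Nat.le_of_lt hlen))

theorem eq_of_actL_eq {l l' : List M} {v : C.V} (hl : D.IsReduced (C.lev v) l)
    (hl' : D.IsReduced (C.lev v) l') (hlen : l.length + l'.length ≤ D.size (C.lev v))
    (h : C.actL l v = C.actL l' v) : l = l' := by
  induction l generalizing l' with
  | nil =>
    by_contra hne
    exact C.actL_ne_of_isReduced hl' (Ne.symm hne) (by simpa using hlen) h.symm
  | cons c l ih =>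
    by_cases hhead : l'.head? = some c
    · obtain ⟨l', rfl⟩ := List.head?_eq_some_iff.1 hhead
      simp only [List.length_cons] at hlen
      rw [ih hl.of_cons hl'.of_cons (by lia) (C.act_injective c h)]
    · refine absurd ?_ (C.actL_ne_of_isReduced (hl.reverse_append hl' hhead) (by simp)
        (by simpa only [List.length_append, List.length_reverse] using hlen))
      rw [actL_append, ← h]
      exact (C.actL_eq_comm.1 rfl).symm

theorem actL_reduce (l : List M) (v : C.V) : C.actL (D.reduce (C.lev v) l) v = C.actL l v := by
  induction l with
  | nil => rfl
  | cons c l ih =>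
    rw [actL_cons, ← ih, Layering.reduce_cons, Layering.reduceCons]
    split_ifs with hc hhead
    · obtain ⟨r, hr⟩ := List.head?_eq_some_iff.1 hhead
      rw [hr, List.tail_cons, actL_cons, act_act]
    · rfl
    · rw [act_of_ne]
      rwa [lev_actL]

theorem actL_eq_self_iff {l : List M} {v : C.V} (hlen : l.length ≤ D.size (C.lev v)) :
    C.actL l v = v ↔ D.reduce (C.lev v) l = [] := by
  rw [← actL_reduce]
  refine ⟨fun h => ?_, fun h => by rw [h, actL_nil]⟩
  by_contra hne
  exact C.actL_ne_of_isReduced (D.isReduced_reduce _ l) hne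
    ((D.length_reduce_le _ l).trans hlen) h

/-- The vertex `y` is at distance more than `R` from `v`. -/
def Far (R : ℕ) (v y : C.V) : Prop :=
  ∀ l : List M, l.length ≤ R → C.actL l v ≠ y

variable {C} in
theorem Far.mono {R R' : ℕ} {v y : C.V} (h : C.Far R' v y) (hR : R ≤ R') : C.Far R v y :=
  fun l hl => h l (hl.trans hR)

theorem exists_pairwise_far (n R k : ℕ) (hk : R + 2 * (n * (R + 1)) < k) :
    ∃ v : ℕ → C.V, (∀ i, C.lev (v i) = k) ∧ ∀ i j, i < j → j ≤ n → C.Far R (v i) (v j) := by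
  choose w hw hlen using D.exists_isReduced_length_eq (k := k) (by lia)
  obtain ⟨u, rfl⟩ := C.nonempty k
  refine ⟨fun i => C.actL (w (i * (R + 1))) u, fun i => C.lev_actL _ u, ?_⟩
  intro i j hij hj l hl heq
  rw [← actL_append] at heq
  have hlen_le := D.length_reduce_le (C.lev u) (l ++ w (i * (R + 1)))
  rw [List.length_append, hlen] at hlen_le
  have hstep : (i + 1) * (R + 1) ≤ j * (R + 1) := Nat.mul_le_mul_right _ hij
  have hjn : j * (R + 1) ≤ n * (R + 1) := Nat.mul_le_mul_right _ hj
  have hsize := D.lt_size (C.lev u)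
  rw [add_mul] at hstep
  have hreduce : D.reduce (C.lev u) (l ++ w (i * (R + 1))) = w (j * (R + 1)) :=
    C.eq_of_actL_eq (D.isReduced_reduce _ _) (hw _) (by rw [hlen]; lia)
      ((C.actL_reduce _ u).trans heq)
  rw [hreduce, hlen] at hlen_le
  lia

theorem exists_far (β : Type*) [Finite β] (R : ℕ) : ∃ K : ℕ, ∀ k, K ≤ k →
    ∀ u : β → C.V, ∃ y, C.lev y = k ∧ ∀ i, C.Far R (u i) y := by
  have := Fintype.ofFinite β
  let n := Fintype.card β
  refine ⟨2 * R + 2 * (n * (2 * R + 1)) + 1, fun k hk u => ?_⟩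
  obtain ⟨v, hv, hfar⟩ := C.exists_pairwise_far n (2 * R) k hk
  by_contra! hnear
  have hball (j : Fin (n + 1)) : ∃ i, ∃ l : List M, l.length ≤ R ∧ C.actL l (u i) = v j := by
    simpa [Far] using hnear (v j) (hv j)
  choose i l hl hact using hball
  obtain ⟨j, j', hne, hij⟩ := Fintype.exists_ne_map_eq_of_card_lt i (by simp [n])
  wlog hlt : j < j' generalizing j j'
  · exact this j' j hne.symm hij.symm (hne.lt_or_gt.resolve_left hlt)
  refine hfar j j' hlt (Nat.lt_succ_iff.1 j'.2) (l j' ++ (l j).reverse) ?_ ?_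
  · rw [List.length_append, List.length_reverse, two_mul]
    exact Nat.add_le_add (hl j') (hl j)
  · rw [actL_append, ← C.actL_eq_comm.1 (hact j), hij, hact]

theorem low_or_near_or_far {β : Type*} (K N : ℕ) (u : β → C.V) (y : C.V) :
    C.lev y < K ∨ (∃ i, ∃ l : List M, l.length ≤ N ∧ C.actL l (u i) = y) ∨
      K ≤ C.lev y ∧ ∀ i, C.Far N (u i) y := by
  by_cases hfar : ∀ i, C.Far N (u i) y
  · exact (lt_or_ge (C.lev y) K).imp_right fun hy => .inr ⟨hy, hfar⟩
  · unfold Far at hfar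
    push Not at hfar
    exact .inr (.inl hfar)

end Coding

end Action

section Simple

variable {L : FirstOrder.Language.{0, 0}} {M : Type} [L.Structure M] {E : L.Relations 2}
  {D : Layering M E}

/-- The relations between colours and vertices that are definable, with parameters, from the
structure on the colours, the levels and the action of colours on vertices, without
quantification over vertices. -/
inductive Simple (C : Coding D) (β : Type) : {α : Type} → ((α → M) → (β → C.V) → Prop) → Prop
  | eq {α : Type} (a b : α) : Simple C β fun x _ => x a = x b
  | const {α : Type} (a : α) (c : M) : Simple C β fun x _ => x a = c
  | rel {α : Type} {n : ℕ} (R : L.Relations n) (a : Fin n → α) :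
      Simple C β fun x _ => Structure.RelMap R fun i => x (a i)
  | lev {α : Type} (a : α) (i : β) : Simple C β fun x v => D.lev (x a) = C.lev (v i)
  | act {α : Type} (l : List α) (i j : β) : Simple C β fun x v => C.actL (l.map x) (v i) = v j
  | vconst {α : Type} (i : β) (f : C.V) : Simple C β fun (_ : α → M) v => v i = f
  | not {α : Type} {Q : (α → M) → (β → C.V) → Prop} (h : Simple C β Q) :
      Simple C β fun x v => ¬ Q x v
  | and {α : Type} {Q Q' : (α → M) → (β → C.V) → Prop} (h : Simple C β Q) (h' : Simple C β Q') :
      Simple C β fun x v => Q x v ∧ Q' x v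
  | ex {α : Type} {Q : (Option α → M) → (β → C.V) → Prop} (h : Simple C β Q) :
      Simple C β fun x v => ∃ c, Q (fun o => o.elim c x) v

variable {C : Coding D} {α α' β β' : Type}

namespace Simple

theorem congr {Q Q' : (α → M) → (β → C.V) → Prop} (h : Simple C β Q)
    (e : ∀ x v, Q x v ↔ Q' x v) : Simple C β Q' := by
  rwa [← funext fun x => funext fun v => propext (e x v)]

theorem or {Q Q' : (α → M) → (β → C.V) → Prop} (h : Simple C β Q) (h' : Simple C β Q') :
    Simple C β fun x v => Q x v ∨ Q' x v :=
  (h.not.and h'.not).not.congr fun _ _ => or_iff_not_and_not.symm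

theorem relabel {Q : (α → M) → (β → C.V) → Prop} (h : Simple C β Q) (τ : α → α') :
    Simple C β fun x v => Q (fun a => x (τ a)) v := by
  induction h generalizing α' with
  | eq a b => exact .eq (τ a) (τ b)
  | const a c => exact .const (τ a) c
  | rel R a => exact .rel R fun i => τ (a i)
  | lev a i => exact .lev (τ a) i
  | act l i j =>
    refine (Simple.act (l.map τ) i j).congr fun x v => ?_
    rw [List.map_map, Function.comp_def]
  | vconst i f => exact .vconst i f
  | not _ ih => exact (ih τ).not
  | and _ _ ih ih' => exact (ih τ).and (ih' τ)
  | ex _ ih =>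
    refine (Simple.ex (ih (Option.map τ))).congr fun x v => exists_congr fun c => ?_
    refine iff_of_eq (congrArg₂ _ (funext fun o => ?_) rfl)
    cases o <;> rfl

theorem exists_tuple {n : ℕ} {Q : (α ⊕ Fin n → M) → (β → C.V) → Prop} (h : Simple C β Q) :
    Simple C β fun x v => ∃ w : Fin n → M, Q (Sum.elim x w) v := by
  induction n generalizing α with
  | zero =>
    refine (h.relabel (Sum.elim id Fin.elim0)).congr fun x v => ?_
    rw [Unique.exists_iff]
    refine iff_of_eq (congrArg₂ _ (funext fun a => ?_) rfl)
    exact a.casesOn (fun _ => rfl) fun i => i.elim0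
  | succ n ih =>
    refine (ih (h.relabel (α' := Option α ⊕ Fin n)
      (Sum.elim (fun a => .inl (some a)) (Fin.cases (.inl none) .inr)))).ex.congr fun x v => ?_
    rw [(Fin.consEquiv fun _ => M).symm.exists_congr_left, Prod.exists]
    refine exists_congr fun c => exists_congr fun w => iff_of_eq (congrArg₂ _ (funext ?_) rfl)
    rintro (a | i)
    · rfl
    · cases i using Fin.cases <;> rfl

theorem lev_eq (a b : α) : Simple C β fun (x : α → M) _ => D.lev (x a) = D.lev (x b) := by
  refine (Simple.rel E ![a, b]).congr fun _ _ => ?_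
  rw [← D.rel_iff]
  refine iff_of_eq (congrArg _ (funext fun i => ?_))
  fin_cases i <;> rfl

theorem lev_const (a : α) (k : ℕ) : Simple C β fun (x : α → M) _ => D.lev (x a) = k := by
  obtain ⟨d, rfl⟩ := D.nonempty k
  refine ((Simple.const none d).and (lev_eq (some a) none)).ex.congr fun _ _ => ?_
  simp only [Option.elim_none, Option.elim_some, exists_eq_left]

theorem prop (p : Prop) : Simple C β fun (_ : α → M) _ => p := by
  have := D.nonempty_type
  have htrue : Simple C β fun (_ : α → M) _ => True :=
    (Simple.ex (Simple.eq none none)).congr fun _ _ => by simp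
  by_cases hp : p
  · exact htrue.congr fun _ _ => by simp [hp]
  · exact htrue.not.congr fun _ _ => by simp [hp]

theorem exists_mem_finite {ι : Type*} {s : Set ι} (hs : s.Finite)
    {Q : ι → (α → M) → (β → C.V) → Prop} (h : ∀ i, Simple C β (Q i)) :
    Simple C β fun x v => ∃ i ∈ s, Q i x v := by
  induction s, hs using Set.Finite.induction_on with
  | empty => exact (prop False).congr fun x v => by simp
  | @insert a _ _ _ ih => exact ((h a).or ih).congr fun x v => by simp

theorem exists_index {ι : Type*} [Finite ι] {Q : ι → (α → M) → (β → C.V) → Prop}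
    (h : ∀ i, Simple C β (Q i)) : Simple C β fun x v => ∃ i, Q i x v :=
  (exists_mem_finite Set.finite_univ h).congr fun x v => by simp

theorem forall_index {ι : Type*} [Finite ι] {Q : ι → (α → M) → (β → C.V) → Prop}
    (h : ∀ i, Simple C β (Q i)) : Simple C β fun x v => ∀ i, Q i x v :=
  (exists_index fun i => (h i).not).not.congr fun x v => by simp

theorem le_lev (a : α) (k : ℕ) : Simple C β fun (x : α → M) _ => k ≤ D.lev (x a) :=
  (exists_mem_finite (Set.finite_lt_nat k) fun j => lev_const a j).not.congr fun _ _ => by simp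

theorem act_const_const (l : List α) (f g : C.V) :
    Simple C β fun (x : α → M) _ => C.actL (l.map x) f = g := by
  induction l generalizing g with
  | nil => exact prop (f = g)
  | cons a l ih =>
    refine ((exists_mem_finite (D.finite (C.lev g)) fun c => (Simple.const a c).and
      (ih (C.act c g))).or ((lev_const a (C.lev g)).not.and (ih g))).congr fun x v => ?_
    rw [List.map_cons, C.actL_cons, C.act_eq_comm]
    by_cases h : D.lev (x a) = C.lev g
    · simp [h]
    · rw [C.act_of_ne h]
      simp only [Set.mem_ofPred_eq, h, not_false_eq_true, true_and, or_iff_right_iff_imp]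
      rintro ⟨c, hc, rfl, -⟩
      exact absurd hc h

theorem act_const (l : List α) (i : β) (f : C.V) :
    Simple C β fun x v => C.actL (l.map x) (v i) = f := by
  refine (exists_mem_finite (C.finite (C.lev f)) fun g =>
    (Simple.vconst i g).and (act_const_const l g f)).congr fun x v => ⟨?_, fun h => ?_⟩
  · rintro ⟨g, -, rfl, hg⟩
    exact hg
  · refine ⟨v i, ?_, rfl, h⟩
    rw [Set.mem_ofPred_eq, ← h, C.lev_actL]

theorem subst {Q : (α → M) → (β → C.V) → Prop} (h : Simple C β Q)
    (σ : β → C.V ⊕ List α × β') :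
    Simple C β' fun x v => Q x fun i => (σ i).elim id fun p => C.actL (p.1.map x) (v p.2) := by
  induction h with
  | eq a b => exact .eq a b
  | const a c => exact .const a c
  | rel R a => exact .rel R a
  | lev a i =>
    rcases hi : σ i with f | ⟨l, k⟩
    · exact (lev_const a (C.lev f)).congr fun x v => by simp [hi]
    · exact (Simple.lev a k).congr fun x v => by simp [hi, C.lev_actL]
  | act l i j =>
    rcases hi : σ i with f | ⟨l', k⟩ <;> rcases hj : σ j with g | ⟨l'', k'⟩ <;>
      simp only [hi, hj, Sum.elim_inl, Sum.elim_inr, id]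
    · exact act_const_const l f g
    · refine (act_const (l.reverse ++ l'') k' f).congr fun x v => ?_
      rw [List.map_append, C.actL_append, List.map_reverse, eq_comm, ← C.actL_eq_comm]
    · refine (act_const (l ++ l') k g).congr fun x v => ?_
      rw [List.map_append, C.actL_append]
    · refine (Simple.act (l''.reverse ++ (l ++ l')) k k').congr fun x v => ?_
      rw [List.map_append, C.actL_append, List.map_append, C.actL_append, List.map_reverse,
        eq_comm, ← C.actL_eq_comm, eq_comm]
  | vconst i f =>
    rcases hi : σ i with g | ⟨l, k⟩
    · exact (prop (g = f)).congr fun x v => by simp [hi]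
    · exact (act_const l k f).congr fun x v => by simp [hi]
  | not _ ih => exact (ih σ).not
  | and _ _ ih ih' => exact (ih σ).and (ih' σ)
  | ex _ ih =>
    refine (ih fun i => (σ i).map id fun p => (p.1.map some, p.2)).ex.congr fun x v => ?_
    refine exists_congr fun c => iff_of_eq (congrArg _ (funext fun i => ?_))
    rcases σ i with g | ⟨l, k⟩
    · simp
    · simp [Function.comp_def]

theorem relabel_vertices {Q : (α → M) → (β → C.V) → Prop} (h : Simple C β Q) (τ : β → β') :
    Simple C β' fun x v => Q x fun i => v (τ i) :=
  h.subst fun i => .inr ([], τ i)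

theorem subst_const {Q : (α → M) → (Option β → C.V) → Prop} (h : Simple C (Option β) Q)
    (f : C.V) : Simple C β fun x v => Q x fun o => o.elim f v := by
  refine (h.subst fun o : Option β => o.elim (.inl f) fun i => .inr ([], i)).congr fun x v => ?_
  refine iff_of_eq (congrArg _ (funext fun o => ?_))
  cases o <;> rfl

theorem subst_actL {Q : (α → M) → (Option β → C.V) → Prop} (h : Simple C (Option β) Q)
    (i : β) (n : ℕ) : Simple C β fun (x : α ⊕ Fin n → M) v =>
      Q (fun a => x (.inl a)) fun o => o.elim (C.actL (List.ofFn fun j => x (.inr j)) (v i)) v := by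
  refine ((h.relabel (Sum.inl : α → α ⊕ Fin n)).subst fun o : Option β =>
    o.elim (.inr (List.ofFn Sum.inr, i)) fun i => .inr ([], i)).congr fun x v => ?_
  refine iff_of_eq (congrArg _ (funext fun o => ?_))
  cases o <;> simp [Function.comp_def]

theorem exists_word_length_le {Q : List M → (α → M) → (β → C.V) → Prop} (N : ℕ)
    (h : ∀ n, Simple C β fun (x : α ⊕ Fin n → M) v =>
      Q (List.ofFn fun j => x (.inr j)) (fun a => x (.inl a)) v) :
    Simple C β fun x v => ∃ l : List M, l.length ≤ N ∧ Q l x v := by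
  refine (exists_index fun n : Fin (N + 1) => (h n).exists_tuple).congr fun x v => ⟨?_, ?_⟩
  · rintro ⟨n, w, hQ⟩
    exact ⟨List.ofFn w, by simpa using Nat.lt_succ_iff.1 n.2, hQ⟩
  · rintro ⟨l, hl, hQ⟩
    refine ⟨⟨l.length, Nat.lt_succ_of_le hl⟩, l.get, ?_⟩
    simpa only [Sum.elim_inr, Sum.elim_inl, List.ofFn_get] using hQ

theorem far (N : ℕ) (i j : β) : Simple C β fun (_ : α → M) v => C.Far N (v i) (v j) := by
  refine (exists_word_length_le (Q := fun l _ v => C.actL l (v i) = v j) N fun n =>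
    (Simple.act (List.ofFn Sum.inr) i j).congr fun _ _ => ?_).not.congr fun _ v => ?_
  · rw [List.map_ofFn, Function.comp_def]
  · simp [Coding.Far]

theorem reduce_eq (a : α) (l r : List α) :
    Simple C β fun (x : α → M) _ => D.reduce (D.lev (x a)) (l.map x) = r.map x := by
  induction l generalizing r with
  | nil =>
    refine (prop (r = [])).congr fun x v => ?_
    rw [List.map_nil, D.reduce_nil, eq_comm (a := []), List.map_eq_nil_iff]
  | cons b l ih =>
    have hpush : Simple C β fun (x : α → M) _ =>
        (D.reduce (D.lev (x a)) (l.map x)).head? ≠ some (x b) ∧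
          x b :: D.reduce (D.lev (x a)) (l.map x) = r.map x := by
      rcases r with _ | ⟨c, _ | ⟨d, r⟩⟩
      · exact (prop False).congr fun x _ => by simp
      · refine ((ih []).and (Simple.eq b c)).congr fun x v => ?_
        simp only [List.map_nil, List.map_cons, List.cons.injEq]
        grind
      · refine (((ih (d :: r)).and (Simple.eq b c)).and (Simple.eq d b).not).congr fun x v => ?_
        simp only [List.map_cons, List.cons.injEq]
        grind
    refine (((lev_eq b a).not.and (ih r)).or
      ((lev_eq b a).and ((ih (b :: r)).or hpush))).congr fun x v => ?_
    rw [List.map_cons, List.map_cons, D.reduce_cons, D.reduceCons_eq_iff]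

/-- Far vertices of the same high level cannot be distinguished, so that such a vertex may be
replaced by any colour `e` of its level. -/
theorem exists_iff_of_far {Q : (α → M) → (Option β → C.V) → Prop} (h : Simple C (Option β) Q) :
    ∃ (N : ℕ) (G : (Option α → M) → (β → C.V) → Prop), Simple C β G ∧
      ∀ (x : α → M) (v : β → C.V) (y : C.V) (e : M), N ≤ C.lev y → D.lev e = C.lev y →
        (∀ i, C.Far N (v i) y) → (Q x (fun o => o.elim y v) ↔ G (fun o => o.elim e x) v) := by
  induction h with
  | eq a b => exact ⟨0, _, .eq (some a) (some b), fun _ _ _ _ _ _ _ => Iff.rfl⟩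
  | const a c => exact ⟨0, _, .const (some a) c, fun _ _ _ _ _ _ _ => Iff.rfl⟩
  | rel R a => exact ⟨0, _, .rel R fun i => some (a i), fun _ _ _ _ _ _ _ => Iff.rfl⟩
  | lev a i =>
    rcases i with _ | i
    · exact ⟨0, _, lev_eq (some a) none, fun x v y e _ he _ => by simp [he]⟩
    · exact ⟨0, _, .lev (some a) i, fun _ _ _ _ _ _ _ => Iff.rfl⟩
  | act l i j =>
    rcases i with _ | i <;> rcases j with _ | j
    · refine ⟨l.length, _, reduce_eq none (l.map some) [], fun x v y e hy he _ => ?_⟩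
      simp only [Option.elim_none, he, List.map_map, Function.comp_def, Option.elim_some,
        List.map_nil]
      exact C.actL_eq_self_iff (by simpa using hy.trans (D.lt_size _).le)
    · refine ⟨l.length, _, prop False, fun x v y e _ _ hfar => iff_false_intro fun h => ?_⟩
      exact hfar j _ (by simp) (C.actL_eq_comm.1 h).symm
    · exact ⟨l.length, _, prop False, fun x v y e _ _ hfar => iff_false_intro (hfar i _ (by simp))⟩
    · exact ⟨0, _, .act (l.map some) i j, fun x v y e _ _ _ => by simp [Function.comp_def]⟩
  | vconst i f =>
    rcases i with _ | i
    · refine ⟨C.lev f + 1, _, prop False, fun x v y e hy _ _ => iff_false_intro ?_⟩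
      rintro rfl
      exact (Nat.lt_of_succ_le hy).false
    · exact ⟨0, _, .vconst i f, fun _ _ _ _ _ _ _ => Iff.rfl⟩
  | not _ ih =>
    obtain ⟨N, G, hG, h⟩ := ih
    exact ⟨N, _, hG.not, fun x v y e hy he hfar => not_congr (h x v y e hy he hfar)⟩
  | and _ _ ih ih' =>
    obtain ⟨N, G, hG, h⟩ := ih
    obtain ⟨N', G', hG', h'⟩ := ih'
    refine ⟨max N N', _, hG.and hG', fun x v y e hy he hfar => and_congr
      (h x v y e (le_of_max_le_left hy) he fun i => ?_)
      (h' x v y e (le_of_max_le_right hy) he fun i => ?_)⟩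
    · exact (hfar i).mono (le_max_left _ _)
    · exact (hfar i).mono (le_max_right _ _)
  | @ex α Q _ ih =>
    obtain ⟨N, G, hG, h⟩ := ih
    let swap : Option (Option α) → Option (Option α)
      | none => some none
      | some none => none
      | some (some a) => some (some a)
    refine ⟨N, _, (hG.relabel swap).ex, fun x v y e hy he hfar => exists_congr fun c => ?_⟩
    refine (h _ v y e hy he hfar).trans (iff_of_eq (congrArg₂ _ (funext fun o => ?_) rfl))
    rcases o with _ | _ | o <;> rfl

/-- A vertex is either one of the finitely many of low level, or it is obtained by a short word from
one of the other vertices, or it is far from them and can be replaced by its level. -/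
theorem exists_vertex [Finite β] {Q : (α → M) → (Option β → C.V) → Prop}
    (h : Simple C (Option β) Q) : Simple C β fun x v => ∃ y, Q x fun o => o.elim y v := by
  obtain ⟨N, G, hG, hgeneric⟩ := h.exists_iff_of_far
  obtain ⟨K, hK⟩ := C.exists_far β N
  refine ((exists_mem_finite (C.finite_lev_lt (max K N)) fun f => h.subst_const f).or
    ((exists_index fun i : β => exists_word_length_le
      (Q := fun l x v => Q x fun o => o.elim (C.actL l (v i)) v) N (h.subst_actL i)).or
      ((le_lev none (max K N)).and hG).ex)).congr fun x v => ⟨?_, ?_⟩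
  · rintro (⟨f, -, hf⟩ | ⟨i, l, -, hl⟩ | ⟨e, he, hGe⟩)
    · exact ⟨f, hf⟩
    · exact ⟨_, hl⟩
    · obtain ⟨y, hy, hfar⟩ := hK (D.lev e) (le_of_max_le_left he) v
      exact ⟨y, (hgeneric x v y e (hy ▸ le_of_max_le_right he) hy.symm hfar).2 hGe⟩
  · rintro ⟨y, hy⟩
    rcases C.low_or_near_or_far (max K N) N v y with hlow | ⟨i, l, hl, rfl⟩ | ⟨hhigh, hfar⟩
    · exact .inl ⟨y, hlow, hy⟩
    · exact .inr (.inl ⟨i, l, hl, hy⟩)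
    · obtain ⟨e, he⟩ := D.nonempty (C.lev y)
      exact .inr (.inr ⟨e, hhigh.trans_eq he.symm,
        (hgeneric x v y e (le_of_max_le_right hhigh) he hfar).1 hy⟩)

end Simple

end Simple

section Interpretation

variable {L : FirstOrder.Language.{0, 0}} {M : Type} [L.Structure M] {E : L.Relations 2}
  {D : Layering M E} {C : Coding D} {α β : Type}

theorem exists_eq_var {K : FirstOrder.Language} [K.IsRelational] {γ : Type*} (t : K.Term γ) :
    ∃ g, t = Term.var g := by
  cases t with
  | var g => exact ⟨g, rfl⟩
  | func f _ => exact isEmptyElim f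

instance : (codeLanguage L).IsRelational :=
  fun _ => inferInstanceAs (IsEmpty Empty)

namespace Coding

theorem exists_color_eq_iff {u v : C.V} {c : M} :
    (∃ h : C.S.Adj u v, C.color h = c) ↔ D.lev c = C.lev u ∧ C.act c u = v := by
  constructor
  · rintro ⟨h, rfl⟩
    exact ⟨lev_color h, (C.act_eq_iff (lev_color h)).2 ⟨h, rfl⟩⟩
  · rintro ⟨h, h'⟩
    exact (C.act_eq_iff h).1 h'

theorem exists_color_eq (C : Coding D) (c : M) : ∃ (u v : C.V) (h : C.S.Adj u v), C.color h = c :=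
  have ⟨u, hu⟩ := C.nonempty (D.lev c)
  ⟨u, _, C.adj_act hu.symm, C.color_adj_act hu.symm⟩

theorem relMap_par_iff (w : Fin 4 → C.V) : C.relMap (CodeRel.par : CodeRel L 4) w ↔
    ∃ (h : C.S.Adj (w 0) (w 1)) (h' : C.S.Adj (w 2) (w 3)), C.color h = C.color h' :=
  exists₂_congr fun _ _ => Quotient.eq.symm.trans C.π.apply_eq_iff_eq.symm

theorem relMap_coded_iff {n : ℕ} (R : L.Relations n) (w : Fin (n * 2) → C.V) (c : Fin n → M)
    (h : ∀ i, ∃ h : C.S.Adj (w (finProdFinEquiv (i, 0))) (w (finProdFinEquiv (i, 1))),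
      C.color h = c i) :
    C.relMap (CodeRel.coded R) w ↔ Structure.RelMap R c := by
  choose hadj hc using h
  obtain rfl : (fun i => C.color (hadj i)) = c := funext hc
  exact ⟨fun ⟨_, hR⟩ => hR, fun hR => ⟨hadj, hR⟩⟩

theorem act_color_eq_iff {p q w t : C.V} (h : C.S.Adj p q) : C.act (C.color h) w = t ↔
    C.relMap (CodeRel.par : CodeRel L 4) ![p, q, w, t] ∨ ¬ C.lev p = C.lev w ∧ w = t := by
  have hpar : C.relMap (CodeRel.par : CodeRel L 4) ![p, q, w, t] ↔
      C.lev p = C.lev w ∧ C.act (C.color h) w = t := by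
    rw [relMap_par_iff, ← lev_color h, ← exists_color_eq_iff]
    exact ⟨fun ⟨_, h', hc⟩ => ⟨h', hc.symm⟩, fun ⟨h', hc⟩ => ⟨h, h', hc.symm⟩⟩
  rw [hpar]
  by_cases hl : C.lev p = C.lev w
  · simp only [hl, true_and, not_true_eq_false, false_and, or_false]
  · rw [C.act_of_ne ((lev_color h).trans_ne hl)]
    simp only [hl, false_and, not_false_eq_true, true_and, false_or]

end Coding

namespace Simple

theorem color (a : α) (i j : β) :
    Simple C β fun x v => ∃ h : C.S.Adj (v i) (v j), C.color h = x a :=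
  ((Simple.lev a i).and (Simple.act [a] i j)).congr fun _ _ => Coding.exists_color_eq_iff.symm

theorem of_relMap {n : ℕ} (R : CodeRel L n) (τ : Fin n → β) :
    Simple C β fun (_ : α → M) v => C.relMap R fun i => v (τ i) := by
  cases R with
  | @coded n R =>
    refine ((forall_index fun i : Fin n => color (Sum.inr i : α ⊕ Fin n)
      (τ (finProdFinEquiv (i, 0))) (τ (finProdFinEquiv (i, 1)))).and
        (Simple.rel R Sum.inr)).exists_tuple.congr fun x v => ⟨?_, ?_⟩
    · rintro ⟨w, hw, hR⟩
      exact (Coding.relMap_coded_iff R _ w hw).2 hR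
    · rintro ⟨h, hR⟩
      exact ⟨fun i => C.color (h i), fun i => ⟨h i, rfl⟩, hR⟩
  | cls =>
    refine ((Simple.lev none (τ 0)).and (Simple.lev none (τ 1))).ex.congr fun x v => ⟨?_, ?_⟩
    · rintro ⟨c, h, h'⟩
      exact h.symm.trans h'
    · intro h
      obtain ⟨c, hc⟩ := D.nonempty (C.lev (v (τ 0)))
      exact ⟨c, hc, Eq.trans hc h⟩
  | edge =>
    refine (color (none : Option α) (τ 0) (τ 1)).ex.congr fun x v => ⟨?_, fun h => ?_⟩
    · rintro ⟨c, h, -⟩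
      exact h
    · exact ⟨C.color h, h, rfl⟩
  | par =>
    refine ((color (none : Option α) (τ 0) (τ 1)).and
      (color (none : Option α) (τ 2) (τ 3))).ex.congr fun x v => ?_
    rw [Coding.relMap_par_iff]
    constructor
    · rintro ⟨c, ⟨h, hc⟩, h', hc'⟩
      exact ⟨h, h', hc.trans hc'.symm⟩
    · rintro ⟨h, h', hc⟩
      exact ⟨_, ⟨h, rfl⟩, h', hc.symm⟩

theorem of_codeBoundedFormula [Finite β] {n : ℕ}
    (φ : (codeLanguage L).BoundedFormula β n) :
    Simple C (β ⊕ Fin n) fun (_ : α → M) v =>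
      φ.Realize (fun i => v (.inl i)) fun j => v (.inr j) := by
  induction φ with
  | falsum => exact prop False
  | equal t t' =>
    obtain ⟨g, rfl⟩ := exists_eq_var t
    obtain ⟨g', rfl⟩ := exists_eq_var t'
    refine (Simple.act [] g g').congr fun _ _ => ?_
    rcases g with g | g <;> rcases g' with g' | g' <;> rfl
  | rel R ts =>
    choose g hg using fun i => exists_eq_var (ts i)
    refine (of_relMap R g).congr fun _ _ => iff_of_eq (congrArg (C.relMap R) (funext fun i => ?_))
    rw [hg]
    rcases g i with j | j <;> rfl
  | imp _ _ ih ih' =>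
    exact (ih.and ih'.not).not.congr fun _ _ => by
      rw [BoundedFormula.realize_imp, not_and_not_right]
  | @all n φ ih =>
    let τ : β ⊕ Fin (n + 1) → Option (β ⊕ Fin n) :=
      Sum.elim (fun i => some (.inl i)) (Fin.snoc (fun j => some (.inr j)) none)
    refine (ih.not.relabel_vertices τ).exists_vertex.not.congr fun _ _ => ?_
    simp only [BoundedFormula.realize_all, not_exists, not_not]
    refine forall_congr' fun y => iff_of_eq (congrArg₂ φ.Realize rfl (funext fun j => ?_))
    refine Fin.lastCases ?_ (fun j => ?_) j <;> simp [τ]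

theorem of_codeFormula [Finite β] (φ : (codeLanguage L).Formula β) :
    Simple C β fun (_ : α → M) v => φ.Realize v :=
  ((of_codeBoundedFormula φ).relabel_vertices (Sum.elim id Fin.elim0)).congr fun _ _ =>
    iff_of_eq (congrArg₂ (BoundedFormula.Realize φ) rfl (Subsingleton.elim _ _))

theorem of_boundedFormula [L.IsRelational] {n : ℕ} (φ : L.BoundedFormula α n) :
    Simple C β fun (x : α ⊕ Fin n → M) _ =>
      φ.Realize (fun i => x (.inl i)) fun j => x (.inr j) := by
  induction φ with
  | falsum => exact prop False
  | equal t t' =>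
    obtain ⟨g, rfl⟩ := exists_eq_var t
    obtain ⟨g', rfl⟩ := exists_eq_var t'
    refine (Simple.eq g g').congr fun _ _ => ?_
    rcases g with g | g <;> rcases g' with g' | g' <;> rfl
  | rel R ts =>
    choose g hg using fun i => exists_eq_var (ts i)
    refine (Simple.rel R g).congr fun _ _ =>
      iff_of_eq (congrArg (Structure.RelMap R) (funext fun i => ?_))
    rw [hg]
    rcases g i with j | j <;> rfl
  | imp _ _ ih ih' =>
    exact (ih.and ih'.not).not.congr fun _ _ => by
      rw [BoundedFormula.realize_imp, not_and_not_right]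
  | @all n φ ih =>
    let τ : α ⊕ Fin (n + 1) → Option (α ⊕ Fin n) :=
      Sum.elim (fun i => some (.inl i)) (Fin.snoc (fun j => some (.inr j)) none)
    refine (ih.not.relabel τ).ex.not.congr fun _ _ => ?_
    simp only [BoundedFormula.realize_all, not_exists, not_not]
    refine forall_congr' fun y => iff_of_eq (congrArg₂ φ.Realize rfl (funext fun j => ?_))
    refine Fin.lastCases ?_ (fun j => ?_) j <;> simp [τ]

theorem of_formula [L.IsRelational] (φ : L.Formula α) :
    Simple C β fun (x : α → M) _ => φ.Realize x :=
  ((of_boundedFormula φ).relabel (Sum.elim id Fin.elim0)).congr fun _ _ =>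
    iff_of_eq (congrArg₂ (BoundedFormula.Realize φ) rfl (Subsingleton.elim _ _))

theorem of_paramDefinable [L.IsRelational] {P : (α → M) → Prop}
    (h : ParamDefinable L P) : Simple C β fun x _ => P x := by
  obtain ⟨n, g, ψ, hψ⟩ := h.exists_formula_fin
  have hvalues (i : Fin n) : Simple C β fun (x : α ⊕ Fin n → M) _ =>
      x (.inr i) = Sum.elim (fun a => x (.inl a)) id (g i) := by
    rcases g i with a | c
    · exact Simple.eq _ _
    · exact Simple.const _ c
  refine ((forall_index hvalues).and ((of_formula ψ).relabel Sum.inr)).exists_tuple.congr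
    fun x _ => (Iff.trans ⟨?_, ?_⟩ (hψ x).symm)
  · rintro ⟨w, hw, h⟩
    rwa [← (funext hw : w = fun i => Sum.elim x id (g i))]
  · exact fun h => ⟨_, fun _ => rfl, h⟩

theorem paramDefinable [IsEmpty β] {Q : (α → M) → (β → C.V) → Prop} (h : Simple C β Q)
    (v : β → C.V) : ParamDefinable L fun x => Q x v := by
  induction h with
  | eq a b => exact .eq a b
  | const a c => exact .eq_const a c
  | rel R a => exact .rel R a
  | lev a i => exact isEmptyElim i
  | act l i j => exact isEmptyElim i
  | vconst i f => exact isEmptyElim i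
  | not _ ih => exact ih.not
  | and _ _ ih ih' => exact ih.and ih'
  | ex _ ih => exact ih.ex

end Simple

/-- A relation between colours and vertices is definable on edges if it becomes definable in the
coding when every colour is represented by an arbitrary edge of that colour. The variables `γ`
stand for vertices; the edge for the colour `a` is given by `s a` and `t a`. -/
def DefinableOnEdges (C : Coding D) (Q : (α → M) → (β → C.V) → Prop) : Prop :=
  ∀ (γ : Type) (s t : α → γ) (r : β → γ), ∃ P : (γ → C.V) → Prop,
    ParamDefinable (codeLanguage L) P ∧
      ∀ (z : γ → C.V) (h : ∀ a, C.S.Adj (z (s a)) (z (t a))),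
        P z ↔ Q (fun a => C.color (h a)) fun i => z (r i)

namespace DefinableOnEdges

theorem relMap {γ : Type} {n : ℕ} (R : CodeRel L n) (s : Fin n → γ) :
    ParamDefinable (codeLanguage L) fun z : γ → C.V => C.relMap R fun i => z (s i) :=
  .rel (L := codeLanguage L) R s

theorem par {γ : Type} (a b c d : γ) : ParamDefinable (codeLanguage L) fun z : γ → C.V =>
    C.relMap (CodeRel.par : CodeRel L 4) ![z a, z b, z c, z d] :=
  (relMap CodeRel.par ![a, b, c, d]).congr fun z => iff_of_eq <| congrArg _ <| funext fun i => by
    fin_cases i <;> rfl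

theorem lev_eq {γ : Type} (a b : γ) :
    ParamDefinable (codeLanguage L) fun z : γ → C.V => C.lev (z a) = C.lev (z b) :=
  relMap CodeRel.cls ![a, b]

theorem eq (a b : α) : DefinableOnEdges C fun x (_ : β → C.V) => x a = x b := by
  refine fun γ s t _ => ⟨_, par (s a) (t a) (s b) (t b), fun z h => ?_⟩
  rw [Coding.relMap_par_iff]
  exact ⟨fun ⟨_, _, h⟩ => h, fun h' => ⟨h a, h b, h'⟩⟩

theorem const (a : α) (c : M) : DefinableOnEdges C fun x (_ : β → C.V) => x a = c := by
  obtain ⟨u, w, huw, rfl⟩ := C.exists_color_eq c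
  refine fun γ s t _ => ⟨_, (relMap CodeRel.par id).subst ![.inl (s a), .inl (t a), .inr u, .inr w],
    fun z h => ?_⟩
  rw [Coding.relMap_par_iff]
  exact ⟨fun ⟨_, _, h⟩ => h, fun h' => ⟨h a, huw, h'⟩⟩

theorem rel {n : ℕ} (R : L.Relations n) (a : Fin n → α) :
    DefinableOnEdges C fun x (_ : β → C.V) => Structure.RelMap R fun i => x (a i) := by
  refine fun γ s t _ => ⟨_, relMap (CodeRel.coded R) fun k =>
    ![s, t] (finProdFinEquiv.symm k).2 (a (finProdFinEquiv.symm k).1), fun z h => ?_⟩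
  refine Coding.relMap_coded_iff R _ _ fun i => ?_
  simp only [Equiv.symm_apply_apply]
  exact ⟨h (a i), rfl⟩

theorem lev (a : α) (i : β) :
    DefinableOnEdges C fun x (v : β → C.V) => D.lev (x a) = C.lev (v i) := by
  refine fun γ s _ r => ⟨_, lev_eq (s a) (r i), fun z h => ?_⟩
  exact iff_of_eq (congrArg (· = _) (Coding.lev_color (h a)).symm)

theorem act (l : List α) (i j : β) :
    DefinableOnEdges C fun x (v : β → C.V) => C.actL (l.map x) (v i) = v j := by
  intro γ s t r
  suffices h : ∀ {γ : Type} (s t : α → γ) (m n : γ), ∃ P : (γ → C.V) → Prop,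
      ParamDefinable (codeLanguage L) P ∧ ∀ (z : γ → C.V) (h : ∀ a, C.S.Adj (z (s a)) (z (t a))),
        P z ↔ C.actL (l.map fun a => C.color (h a)) (z m) = z n from h s t (r i) (r j)
  intro γ s t m n
  induction l generalizing γ with
  | nil => exact ⟨_, .eq m n, fun _ _ => Iff.rfl⟩
  | cons a l ih =>
    obtain ⟨P, hP, h⟩ := ih (fun a => some (s a)) (fun a => some (t a)) (some m) none
    refine ⟨_, (hP.and ((par (some (s a)) (some (t a)) none (some n)).or
      ((lev_eq (some (s a)) none).not.and (.eq none (some n))))).ex,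
      fun z hz => ?_⟩
    simp only [h (fun o : Option γ => o.elim _ z) hz, Option.elim_none, Option.elim_some,
      List.map_cons, C.actL_cons, Coding.act_color_eq_iff (hz a)]
    exact ⟨fun ⟨_, hc, ht⟩ => hc ▸ ht, fun ht => ⟨_, rfl, ht⟩⟩

theorem vconst (i : β) (f : C.V) : DefinableOnEdges C fun (_ : α → M) v => v i = f :=
  fun _ _ _ r => ⟨_, .eq_const (r i) f, fun _ _ => Iff.rfl⟩

theorem not {Q : (α → M) → (β → C.V) → Prop} (h : DefinableOnEdges C Q) :
    DefinableOnEdges C fun x v => ¬ Q x v := fun γ s t r =>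
  have ⟨_, hP, h⟩ := h γ s t r
  ⟨_, hP.not, fun z hz => not_congr (h z hz)⟩

theorem and {Q Q' : (α → M) → (β → C.V) → Prop} (h : DefinableOnEdges C Q)
    (h' : DefinableOnEdges C Q') : DefinableOnEdges C fun x v => Q x v ∧ Q' x v := fun γ s t r =>
  have ⟨_, hP, h⟩ := h γ s t r
  have ⟨_, hP', h'⟩ := h' γ s t r
  ⟨_, hP.and hP', fun z hz => and_congr (h z hz) (h' z hz)⟩

theorem ex {Q : (Option α → M) → (β → C.V) → Prop} (h : DefinableOnEdges C Q) :
    DefinableOnEdges C fun x v => ∃ c, Q (fun o => o.elim c x) v := by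
  intro γ s t r
  obtain ⟨P, hP, h⟩ := h (Option (Option γ)) (fun o => o.elim none fun a => some (some (s a)))
    (fun o => o.elim (some none) fun a => some (some (t a))) fun i => some (some (r i))
  refine ⟨_, ((relMap CodeRel.edge ![none, some none]).and hP).ex.ex, fun z hz => ?_⟩
  have hcolor (p q : C.V) (hpq : C.S.Adj p q) :
      (P fun o : Option (Option γ) => o.elim p fun o => o.elim q z) ↔
        Q (fun o => o.elim (C.color hpq) fun a => C.color (hz a)) fun i => z (r i) := by
    refine (h (fun o : Option (Option γ) => o.elim p fun o => o.elim q z)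
      fun o => o.casesOn hpq hz).trans (iff_of_eq (congrArg₂ Q (funext fun o => ?_) rfl))
    cases o <;> rfl
  constructor
  · rintro ⟨q, p, hpq, hP⟩
    exact ⟨_, (hcolor p q hpq).1 hP⟩
  · rintro ⟨c, hQ⟩
    obtain ⟨p, q, hpq, rfl⟩ := C.exists_color_eq c
    exact ⟨q, p, hpq, (hcolor p q hpq).2 hQ⟩

end DefinableOnEdges

namespace Simple

theorem definableOnEdges {Q : (α → M) → (β → C.V) → Prop} (h : Simple C β Q) :
    DefinableOnEdges C Q := by
  induction h with
  | eq a b => exact .eq a b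
  | const a c => exact .const a c
  | rel R a => exact .rel R a
  | lev a i => exact .lev a i
  | act l i j => exact .act l i j
  | vconst i f => exact .vconst i f
  | not _ ih => exact ih.not
  | and _ _ ih ih' => exact ih.and ih'
  | ex _ ih => exact ih.ex

theorem paramDefinable_code [IsEmpty α] {Q : (α → M) → (β → C.V) → Prop} (h : Simple C β Q)
    (x : α → M) : ParamDefinable (codeLanguage L) fun v => Q x v :=
  have ⟨_, hP, h⟩ := h.definableOnEdges β isEmptyElim isEmptyElim id
  hP.congr fun v => (h v isEmptyElim).trans (iff_of_eq (congrArg (Q · v) (Subsingleton.elim _ _)))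

end Simple

end Interpretation

section Transfer

variable {L : FirstOrder.Language.{0, 0}} {M : Type} [L.Structure M] {E : L.Relations 2}
  {D : Layering M E} {C : Coding D}

/-- The vertex `y` is of low level, or it is obtained by a short word from an element of one member
`v t₀` of the family, or it is far from all of them and only its level matters. The letters of the
word or a colour of the level of `y` serve as `w`. -/
theorem Simple.exists_cover {α β : Type} [Finite β] {Q : (α → M) → (Option β → C.V) → Prop}
    (h : Simple C (Option β) Q) :
    ∃ (I : Type) (_ : Finite I) (A : I → Type)
      (G : ∀ i, (α ⊕ A i → M) → (β ⊕ β → C.V) → Prop), (∀ i, Simple C (β ⊕ β) (G i)) ∧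
      ∀ (T : Type) [Nonempty T] (v : T → β → C.V) (y : C.V), ∃ (i : I) (w : A i → M) (t₀ : T),
        ∀ x t, Q x (fun o => o.elim y (v t)) ↔ G i (Sum.elim x w) (Sum.elim (v t₀) (v t)) := by
  obtain ⟨N, G, hG, hgeneric⟩ := h.exists_iff_of_far
  have : Finite {f : C.V // C.lev f < N} := C.finite_lev_lt N
  refine ⟨{f : C.V // C.lev f < N} ⊕ (β × Fin (N + 1)) ⊕ Unit, inferInstance,
    Sum.elim (fun _ => Empty) (Sum.elim (fun p => Fin p.2) fun _ => Unit), fun i => match i with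
      | .inl f => fun x v => Q (fun a => x (.inl a)) fun o => o.elim f.1 fun i => v (.inr i)
      | .inr (.inl p) => fun x v => Q (fun a => x (.inl a)) fun o =>
          o.elim (C.actL (List.ofFn fun j => x (.inr j)) (v (.inl p.1))) fun i => v (.inr i)
      | .inr (.inr _) => fun x v => G (fun o => o.elim (x (.inr ())) fun a => x (.inl a))
          fun i => v (.inr i), ?_, fun T _ v y => ?_⟩
  · rintro (f | ⟨i, n⟩ | _)
    · exact ((h.subst_const f.1).relabel_vertices Sum.inr).relabel Sum.inl
    · refine ((h.relabel_vertices (Option.map Sum.inr)).subst_actL (.inl i) n).congr fun x v => ?_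
      refine iff_of_eq (congrArg _ (funext fun o => ?_))
      cases o <;> rfl
    · refine ((hG.relabel (α' := α ⊕ Unit) fun o => o.elim (.inr ()) .inl).relabel_vertices
        .inr).congr fun x v => ?_
      refine iff_of_eq (congrArg₂ _ (funext fun o => ?_) rfl)
      cases o <;> rfl
  · rcases C.low_or_near_or_far N N (fun p : T × β => v p.1 p.2) y with
      hlow | ⟨⟨t₀, i⟩, l, hl, rfl⟩ | ⟨hhigh, hfar⟩
    · exact ⟨.inl ⟨y, hlow⟩, Empty.elim, Classical.arbitrary T, fun x t => Iff.rfl⟩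
    · refine ⟨.inr (.inl (i, ⟨l.length, Nat.lt_succ_of_le hl⟩)), l.get, t₀, fun x t => ?_⟩
      simp only [Sum.elim_inl, Sum.elim_inr, List.ofFn_get]
    · obtain ⟨e, he⟩ := D.nonempty (C.lev y)
      exact ⟨.inr (.inr ()), fun _ => e, Classical.arbitrary T, fun x t =>
        hgeneric x (v t) y e hhigh he fun i => hfar (t, i)⟩

/-- Simple relations with objects in `(α → M) × (β → C.V)` and parameters in
`(α' → M) × (β' → C.V)`, for arbitrary `α` and `α'`, are polynomially bounded. -/
def VertexBounded (C : Coding D) (β β' : Type) : Prop :=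
  ∀ (α α' : Type) (Q : (α ⊕ α' → M) → (β ⊕ β' → C.V) → Prop), Simple C (β ⊕ β') Q →
    PolyBounded fun (x : (α → M) × (β → C.V)) (b : (α' → M) × (β' → C.V)) =>
      Q (Sum.elim x.1 b.1) (Sum.elim x.2 b.2)

namespace VertexBounded

variable {β β' : Type}

theorem symm (h : VertexBounded C β β') : VertexBounded C β' β := by
  intro α α' Q hQ
  refine (h α' α _ ((hQ.relabel Sum.swap).relabel_vertices Sum.swap)).flip.congr fun x b => ?_
  refine iff_of_eq (congrArg₂ Q (funext fun o => ?_) (funext fun o => ?_)) <;> cases o <;> rfl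

theorem of_equiv {β₁ β₂ : Type} (e : β₁ ≃ β₂) (h : VertexBounded C β₁ β') :
    VertexBounded C β₂ β' := by
  intro α α' Q hQ
  refine ((h α α' _ (hQ.relabel_vertices (Sum.map e.symm id))).comp
    (fun x => (x.1, fun i => x.2 (e i))) id).congr fun x b => ?_
  refine iff_of_eq (congrArg (Q _) (funext fun o => ?_))
  rcases o with o | o <;> simp

theorem of_isEmpty [IsEmpty β] [IsEmpty β'] (h : IsNIP (L.completeTheory M)) :
    VertexBounded C β β' := by
  have := D.nonempty_type
  intro α α' Q hQ
  refine ((h.polyBounded_of_paramDefinable (hQ.paramDefinable isEmptyElim)).comp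
    Prod.fst Prod.fst).congr fun x b => ?_
  rw [Subsingleton.elim (Sum.elim x.2 b.2) isEmptyElim]

/-- One vertex of the object is traded for elements of `M` and the vertices of one member of the
family of parameters, which is why the number of vertices of a parameter doubles. -/
theorem option [Finite β] [Finite β'] (h : VertexBounded C β (β' ⊕ β')) :
    VertexBounded C (Option β) β' := by
  intro α α' Q hQ
  have hQ' := hQ.relabel_vertices (β' := Option (β ⊕ β'))
    (Sum.elim (Option.map .inl) fun j => some (.inr j))
  obtain ⟨I, _, A, G, hG, hcover⟩ := hQ'.exists_cover
  refine .of_object_cover 1 (W := fun i => (α ⊕ A i → M) × (β → C.V))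
    (P := fun i x b => G i
      (Sum.elim (Sum.elim (fun a => x.1 (.inl a)) b.2.1) fun j => x.1 (.inr j))
      (Sum.elim (Sum.elim x.2 (b.1 0).2) (Sum.elim x.2 b.2.2))) (fun i => ?_)
    fun T _ _ b x => ?_
  · have hG' := ((hG i).relabel (α' := (α ⊕ A i) ⊕ α')
      (Sum.elim (Sum.map .inl id) fun j => .inl (.inr j))).relabel_vertices
        (β' := β ⊕ (β' ⊕ β')) (Sum.elim (Sum.map id .inl) (Sum.map id .inr))
    refine ((h _ _ _ hG').comp id fun b => (b.2.1, Sum.elim (b.1 0).2 b.2.2)).congr fun x b => ?_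
    refine iff_of_eq (congrArg₂ (G i) (funext fun a => ?_) (funext fun o => ?_))
    · rcases a with (a | a) | a <;> rfl
    · rcases o with (o | o) | o | o <;> rfl
  · obtain ⟨i, w, t₀, hw⟩ := hcover T (fun t => Sum.elim (fun j => x.2 (some j)) (b t).2) (x.2 none)
    refine ⟨i, (Sum.elim x.1 w, fun j => x.2 (some j)), fun _ => t₀, fun t => ?_⟩
    refine Iff.trans (iff_of_eq (congrArg (Q _) (funext fun o => ?_))) (hw (Sum.elim x.1 (b t).1) t)
    rcases o with (_ | o) | o <;> rfl

theorem of_isEmpty_right [Finite β] (h : IsNIP (L.completeTheory M)) :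
    ∀ (β' : Type) [IsEmpty β'], VertexBounded C β β' := by
  induction β using Finite.induction_empty_option with
  | of_equiv e ih => exact fun β' _ => (ih β').of_equiv e
  | h_empty => exact fun β' _ => of_isEmpty h
  | h_option ih => exact fun β' _ => (ih (β' ⊕ β')).option

theorem of_isNIP [Finite β] (h : IsNIP (L.completeTheory M)) :
    ∀ (β' : Type) [Finite β'], VertexBounded C β β' := by
  induction β using Finite.induction_empty_option with
  | of_equiv e ih => exact fun β' _ => (ih β').of_equiv e
  | h_empty => exact fun β' _ => (of_isEmpty_right h PEmpty).symm
  | h_option ih => exact fun β' _ => (ih (β' ⊕ β')).option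

end VertexBounded

theorem Coding.isNIP (C : Coding D) (h : IsNIP (L.completeTheory M)) :
    IsNIP ((codeLanguage L).completeTheory C.V) := by
  refine isNIP_of_polyBounded fun n m φ => ?_
  have hφ : Simple C (Fin m ⊕ Fin n) fun (_ : Empty ⊕ Empty → M) v =>
      φ.Realize fun i => v i.swap := (Simple.of_codeFormula φ).relabel_vertices Sum.swap
  refine ((VertexBounded.of_isNIP h (Fin n) Empty Empty _ hφ).comp
    (fun b : Fin m → C.V => (Empty.elim, b)) fun a : Fin n → C.V => (Empty.elim, a)).congr
    fun b a => ?_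
  refine iff_of_eq (congrArg φ.Realize (funext fun o => ?_))
  rcases o with o | o <;> rfl

end Transfer

section Definability

variable {L : FirstOrder.Language.{0, 0}} {M : Type} [L.Structure M] {E : L.Relations 2}
  {D : Layering M E} {C : Coding D}

theorem Simple.quantifier_near {β : Type} (F : (M → Prop) → Prop)
    (hF : ∀ (α : Type) (Q : (Option α → M) → (β → C.V) → Prop), Simple C β Q →
      Simple C β fun x v => F fun e => Q (fun o => o.elim e x) v)
    {α : Type} {Q : (Option α → M) → (Option β → C.V) → Prop} (h : Simple C (Option β) Q)
    (N : ℕ) (i : β) :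
    Simple C (Option β) fun x v => ∃ l : List M, l.length ≤ N ∧
      C.actL l (v (some i)) = v none ∧ F fun e => Q (fun o => o.elim e x) fun o =>
        o.elim (C.actL l (v (some i))) fun j => v (some j) := by
  refine exists_word_length_le (Q := fun l x v => C.actL l (v (some i)) = v none ∧
    F fun e => Q (fun o => o.elim e x) fun o =>
      o.elim (C.actL l (v (some i))) fun j => v (some j)) N fun n => ?_
  refine ((Simple.act (List.ofFn Sum.inr) (some i) none).and
    ((hF (α ⊕ Fin n) _ ((h.subst_actL i n).relabel
      (Sum.elim (Option.map .inl) fun j => some (.inr j)))).relabel_vertices some)).congr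
    fun x v => ?_
  rw [List.map_ofFn, Function.comp_def]
  refine and_congr_right fun _ => iff_of_eq (congrArg F (funext fun e => ?_))
  refine congrArg₂ Q (funext fun o => ?_) rfl
  cases o <;> rfl

theorem Simple.quantifier_far {β : Type} [Finite β] (F : (M → Prop) → Prop)
    (hF : ∀ (α : Type) (Q : (Option α → M) → (β → C.V) → Prop), Simple C β Q →
      Simple C β fun x v => F fun e => Q (fun o => o.elim e x) v)
    {α : Type} {G : (Option (Option α) → M) → (β → C.V) → Prop} (hG : Simple C β G) (N : ℕ) :
    Simple C (Option β) fun (x : α → M) v => (∀ i, C.Far N (v (some i)) (v none)) ∧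
      ∃ g : M, D.lev g = C.lev (v none) ∧ N ≤ D.lev g ∧
        F fun e => G (fun o => o.elim g fun o => o.elim e x) fun j => v (some j) := by
  have hG' := hG.relabel (α' := Option (Option α))
    fun o => o.elim (some none) fun o => o.elim none fun a => some (some a)
  refine (forall_index fun i => Simple.far N (some i) none).and (((Simple.lev none none).and
    ((le_lev none N).and ((hF (Option α) _ hG').relabel_vertices some))).ex.congr fun x v => ?_)
  refine exists_congr fun g => and_congr_right fun _ => and_congr_right fun _ => ?_
  refine iff_of_eq (congrArg F (funext fun e => congrArg₂ G (funext fun o => ?_) rfl))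
  rcases o with _ | _ | o <;> rfl

theorem Simple.quantifier_option {β : Type} [Finite β] (F : (M → Prop) → Prop)
    (hF : ∀ (α : Type) (Q : (Option α → M) → (β → C.V) → Prop), Simple C β Q →
      Simple C β fun x v => F fun e => Q (fun o => o.elim e x) v)
    {α : Type} {Q : (Option α → M) → (Option β → C.V) → Prop} (h : Simple C (Option β) Q) :
    Simple C (Option β) fun x v => F fun e => Q (fun o => o.elim e x) v := by
  obtain ⟨N, G, hG, hgeneric⟩ := h.exists_iff_of_far
  have low (f : C.V) : Simple C (Option β) fun (x : α → M) v => v none = f ∧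
      F fun e => Q (fun o => o.elim e x) fun o => o.elim f fun j => v (some j) :=
    (vconst none f).and ((hF α _ (h.subst_const f)).relabel_vertices some)
  refine ((exists_mem_finite (C.finite_lev_lt N) low).or
    ((exists_index (h.quantifier_near F hF N)).or (hG.quantifier_far F hF N))).congr fun x v => ?_
  obtain ⟨y, v, rfl⟩ : ∃ y v', v = fun o : Option β => o.elim y v' :=
    ⟨v none, fun j => v (some j), funext fun o => by cases o <;> rfl⟩
  simp only [Option.elim_none, Option.elim_some]
  constructor
  · rintro (⟨f, -, rfl, hF⟩ | ⟨i, l, -, rfl, hF⟩ | ⟨hfar, g, hg, hN, hF⟩)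
    · exact hF
    · exact hF
    · simpa only [hgeneric _ v y g (hg ▸ hN) hg hfar] using hF
  · intro hF
    rcases C.low_or_near_or_far N N v y with hlow | ⟨i, l, hl, rfl⟩ | ⟨hhigh, hfar⟩
    · exact .inl ⟨y, hlow, rfl, hF⟩
    · exact .inr (.inl ⟨i, l, hl, rfl, hF⟩)
    · obtain ⟨g, hg⟩ := D.nonempty (C.lev y)
      refine .inr (.inr ⟨hfar, g, hg, hhigh.trans_eq hg.symm, ?_⟩)
      simpa only [hgeneric _ v y g hhigh hg hfar] using hF

/-- The vertices are traded for elements of `M` one after the other, until `hF` applies. -/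
theorem Simple.quantifier [L.IsRelational] {β : Type} [Finite β] (F : (M → Prop) → Prop)
    (hF : ∀ (α : Type) (Q : (Option α → M) → Prop), ParamDefinable L Q →
      ParamDefinable L fun x : α → M => F fun e => Q fun o => o.elim e x) :
    ∀ {α : Type} {Q : (Option α → M) → (β → C.V) → Prop}, Simple C β Q →
      Simple C β fun x v => F fun e => Q (fun o => o.elim e x) v := by
  induction β using Finite.induction_empty_option with
  | of_equiv e ih =>
    intro α Q hQ
    refine ((ih (hQ.relabel_vertices e.symm)).relabel_vertices e).congr fun x v => ?_
    simp only [Equiv.apply_symm_apply]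
  | h_empty =>
    intro α Q hQ
    refine (Simple.of_paramDefinable (hF α _ (hQ.paramDefinable PEmpty.elim))).congr fun x v => ?_
    rw [Subsingleton.elim v PEmpty.elim]
  | h_option ih => exact Simple.quantifier_option F fun _ _ => ih

theorem Layering.exists_formula_saturation (D : Layering M E) {m : ℕ}
    (ψ : L.Formula (Fin 1 ⊕ Fin m)) : ∃ χ : L.Formula (Fin 1 ⊕ Fin m), ∀ e b,
      χ.Realize (Sum.elim ![e] b) ↔ ∃ e', D.lev e' = D.lev e ∧ ψ.Realize (Sum.elim ![e'] b) := by
  refine ⟨(E.formula₂ (Term.var (.inr 0)) (Term.var (.inl (.inl 0))) ⊓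
    ψ.relabel (Sum.elim .inr fun j => .inl (.inr j))).iExs (Fin 1), fun e b => ?_⟩
  simp only [Formula.realize_iExs, Formula.realize_inf, Formula.realize_rel₂,
    Formula.realize_relabel]
  refine (Equiv.funUnique (Fin 1) M).exists_congr fun w => and_congr (D.rel_iff _ _) ?_
  refine iff_of_eq (congrArg ψ.Realize (funext fun o => ?_))
  rcases o with o | o
  · rw [Subsingleton.elim o 0]
    rfl
  · rfl

theorem NewClassTypesDefinable.paramDefinable (h : NewClassTypesDefinable M E) (D : Layering M E)
    (u : Ultrafilter M) (hu : ∀ k, ∀ᶠ e in u, k ≤ D.lev e) {α : Type} {Q : (Option α → M) → Prop}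
    (hQ : ParamDefinable L Q) : ParamDefinable L fun x : α → M =>
      ∀ᶠ e in u, ∃ e', D.lev e' = D.lev e ∧ Q fun o => o.elim e' x := by
  have := D.nonempty_type
  obtain ⟨m, ψ, s, hψ⟩ := (hQ.comp
    (fun o => o.elim (.inl 0) .inr : Option α → Fin 1 ⊕ α)).exists_formula_sum
  obtain ⟨χ, hχ⟩ := D.exists_formula_saturation ψ
  obtain ⟨p, hp⟩ := exists_type_of_ultrafilter (L := L) u fun e : M => ![e]
  have hdef : ParamDefinable L fun b => b ∈ defSet p χ := by
    refine h p (fun b hb => ?_) m χ fun a a' b haa' => ?_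
    · obtain ⟨e, he, hlev⟩ := (((hp _ _ _).1 hb).and (hu (D.lev b + 1))).exists
      exact (Nat.lt_of_succ_le hlev).ne' ((D.rel_iff e b).1 (Formula.realize_rel₂.1 he))
    · rw [hχ, hχ, (D.rel_iff _ _).1 haa']
  refine (hdef.subst s).congr fun x => (hp _ _ _).trans ?_
  refine Filter.eventually_congr (Filter.Eventually.of_forall fun e => (hχ e _).trans ?_)
  refine exists_congr fun e' => and_congr_right fun _ => (hψ ![e'] x).symm.trans ?_
  refine iff_of_eq (congrArg Q (funext fun o => ?_))
  cases o <;> rfl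

theorem Coding.paramDefinable_eventually [L.IsRelational] (C : Coding D)
    (h : NewClassTypesDefinable M E) (u : Ultrafilter C.V) {β : Type} [Finite β]
    {Q : (Empty → M) → (Option β → C.V) → Prop} (hQ : Simple C (Option β) Q) :
    ParamDefinable (codeLanguage L) fun v : β → C.V =>
      ∀ᶠ y in u, Q Empty.elim fun o => o.elim y v := by
  by_cases hu : ∀ k, ∀ᶠ y in u, k ≤ C.lev y
  · obtain ⟨N, G, hG, hgeneric⟩ := hQ.exists_iff_of_far
    choose s hs using D.nonempty
    replace hs : ∀ k, D.lev (s k) = k := hs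
    have hlev (k : ℕ) : ∀ᶠ e in u.map fun y => s (C.lev y), k ≤ D.lev e :=
      Filter.eventually_map.2 ((hu k).mono fun y hy => by rwa [hs])
    refine ((hG.quantifier (fun p => ∀ᶠ e in u.map fun y => s (C.lev y), ∃ e',
      D.lev e' = D.lev e ∧ p e') fun α Q hQ => h.paramDefinable D _ hlev hQ).paramDefinable_code
        Empty.elim).congr fun v => ?_
    refine Filter.eventually_map.trans (Filter.eventually_congr ?_)
    have hv : ∀ᶠ y in (u : Filter C.V), ∀ i, C.lev (v i) + 1 ≤ C.lev y :=
      Filter.eventually_all.2 fun i => hu _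
    filter_upwards [hu N, hv] with y hN hy
    have hfar (i : β) : C.Far N (v i) y := by
      rintro l - rfl
      exact (Nat.lt_of_succ_le (hy i)).ne' (C.lev_actL l (v i))
    refine ⟨fun ⟨e, he, hGe⟩ => ?_, fun hy => ⟨s (C.lev y), rfl, ?_⟩⟩
    · exact (hgeneric _ v y e hN (he.trans (hs _)) hfar).2 hGe
    · exact (hgeneric _ v y _ hN (hs _) hfar).1 hy
  · push Not at hu
    obtain ⟨k, hk⟩ := hu
    obtain ⟨f, -, rfl⟩ := Ultrafilter.eq_pure_of_finite_mem (C.finite_lev_lt k) hk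
    exact (hQ.subst_const f).paramDefinable_code Empty.elim

theorem Coding.paramDefinable_eventually_realize [L.IsRelational] (C : Coding D)
    (h : NewClassTypesDefinable M E) (u : Ultrafilter (Fin 1 → C.V)) {m : ℕ}
    (φ : (codeLanguage L).Formula (Fin 1 ⊕ Fin m)) :
    ParamDefinable (codeLanguage L) fun b : Fin m → C.V =>
      ∀ᶠ x in (u : Filter (Fin 1 → C.V)), φ.Realize (Sum.elim x b) := by
  refine (C.paramDefinable_eventually h (u.map fun x => x 0) ((Simple.of_codeFormula
    φ).relabel_vertices (Sum.elim (fun _ => none) some))).congr fun b => ?_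
  refine Filter.eventually_map.trans (Filter.eventually_congr (Filter.Eventually.of_forall ?_))
  refine fun x => iff_of_eq (congrArg φ.Realize (funext fun o => ?_))
  rcases o with o | o
  · rw [Subsingleton.elim o 0]
    rfl
  · rfl

theorem Coding.isDefinableType [L.IsRelational] (C : Coding D) (h : NewClassTypesDefinable M E)
    (p : TypeOver (codeLanguage L) C.V 1) : IsDefinableType p := by
  obtain ⟨u, hu⟩ := exists_ultrafilter_of_type p
  exact fun m φ => (C.paramDefinable_eventually_realize h u φ).congr fun b => (hu m φ b).symm

theorem Coding.infStablyEmbedded_one [L.IsRelational] (C : Coding D)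
    (h : NewClassTypesDefinable M E) {N : Type} [(codeLanguage L).Structure N]
    (f : C.V ↪ₑ[codeLanguage L] N) : InfStablyEmbedded (codeLanguage L) (Set.range f) 1 := by
  obtain ⟨v₀, -⟩ := C.nonempty 0
  have : Nonempty C.V := ⟨v₀⟩
  refine (infStablyEmbedded_range_iff f 1).2 fun n k hk φ a => ?_
  rcases Nat.le_one_iff_eq_zero_or_eq_one.1 hk with rfl | rfl
  · refine ((ParamDefinable.of_formula φ).comp (Sum.elim id Fin.elim0)).congr fun z => ?_
    rw [← f.map_formula]
    refine iff_of_eq (congrArg φ.Realize (funext fun o => ?_))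
    exact o.casesOn (fun _ => rfl) fun i => i.elim0
  · refine (C.paramDefinable_eventually_realize h (.of (traceFilter f a))
      (φ.relabel Sum.swap)).congr fun z => ?_
    rw [← realize_iff_eventually_traceFilter, Formula.realize_relabel, Sum.elim_swap]

end Definability

section Existence

variable {L : FirstOrder.Language.{0, 0}} {M : Type} [L.Structure M] {E : L.Relations 2}
  {D : Layering M E}

/-- An action of the elements of `M` by involutions on a set that is split into finite pieces, such
that on the `k`-th piece no short reduced word over the `k`-th class has a fixed point. Joining the
vertices `v` and `act c v`, for `c` of the level of `v`, produces a coding. -/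
structure Layering.LocallyFreeAction (D : Layering M E) where
  V : Type
  lev : V → ℕ
  nonempty : ∀ k, {v | lev v = k}.Nonempty
  finite : ∀ k, {v | lev v = k}.Finite
  act : M → V → V
  lev_act : ∀ c v, lev (act c v) = lev v
  act_act : ∀ c v, act c (act c v) = v
  foldr_act_ne : ∀ l v, l ≠ [] → D.IsReduced (lev v) l → l.length ≤ D.size (lev v) →
    l.foldr act v ≠ v

namespace Layering.LocallyFreeAction

variable (A : D.LocallyFreeAction) {c d : M} {v : A.V}

theorem act_ne (hc : D.lev c = A.lev v) : A.act c v ≠ v :=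
  A.foldr_act_ne [c] v (List.cons_ne_nil _ _) (.cons .nil hc (by simp))
    ((Nat.zero_le _).trans_lt (D.lt_size _))

theorem eq_of_act_eq (hc : D.lev c = A.lev v) (hd : D.lev d = A.lev v)
    (h : A.act c v = A.act d v) : c = d := by
  by_contra hcd
  have hsize : 2 ≤ D.size (A.lev v) := by
    rw [← Set.ncard_pair hcd]
    exact Set.ncard_le_ncard (Set.pair_subset hc hd) (D.finite _)
  refine A.foldr_act_ne [d, c] v (List.cons_ne_nil _ _)
    (.cons (.cons .nil hc (by simp)) hd (by simpa using hcd)) hsize ?_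
  rw [List.foldr_cons, List.foldr_cons, List.foldr_nil, h, A.act_act]

theorem lev_foldr_act (l : List M) (v : A.V) : A.lev (l.foldr A.act v) = A.lev v := by
  induction l with
  | nil => rfl
  | cons c l ih => rw [List.foldr_cons, A.lev_act, ih]

/-- The graph in which `v` is joined to `act c v` for all `c` of the level of `v`. -/
def graph : SimpleGraph A.V where
  Adj u w := ∃ c, D.lev c = A.lev u ∧ A.act c u = w
  symm := ⟨by
    rintro u _ ⟨c, hc, rfl⟩
    exact ⟨c, hc.trans (A.lev_act c u).symm, A.act_act c u⟩⟩
  loopless := ⟨fun _ ⟨_, hc, h⟩ => A.act_ne hc h⟩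

theorem adj_act (hc : D.lev c = A.lev v) : A.graph.Adj v (A.act c v) :=
  ⟨c, hc, rfl⟩

theorem exists_color (e : A.graph.edgeSet) :
    ∃ c, ∀ v w, e.1 = s(v, w) → D.lev c = A.lev v ∧ A.act c v = w := by
  obtain ⟨e, he⟩ := e
  induction e using Sym2.ind with
  | _ u w =>
  obtain ⟨c, hc, hcu⟩ : ∃ c, D.lev c = A.lev u ∧ A.act c u = w := he
  refine ⟨c, fun v w' h => ?_⟩
  rcases Sym2.eq_iff.1 h with ⟨rfl, rfl⟩ | ⟨rfl, rfl⟩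
  · exact ⟨hc, hcu⟩
  · rw [← hcu]
    exact ⟨hc.trans (A.lev_act c u).symm, A.act_act c u⟩

/-- The element of `M` by which the two ends of an edge are exchanged. -/
noncomputable def color (e : A.graph.edgeSet) : M :=
  (A.exists_color e).choose

variable {A}

theorem lev_color {e : A.graph.edgeSet} (hv : v ∈ e.1) : D.lev (A.color e) = A.lev v := by
  obtain ⟨w, hw⟩ := Sym2.mem_iff_exists.1 hv
  exact ((A.exists_color e).choose_spec v w hw).1

theorem eq_act_color {e : A.graph.edgeSet} (hv : v ∈ e.1) : e.1 = s(v, A.act (A.color e) v) := by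
  obtain ⟨w, hw⟩ := Sym2.mem_iff_exists.1 hv
  rw [color, ((A.exists_color e).choose_spec v w hw).2, hw]

theorem color_act (hc : D.lev c = A.lev v) : A.color ⟨s(v, A.act c v), A.adj_act hc⟩ = c := by
  let e : A.graph.edgeSet := ⟨s(v, A.act c v), A.adj_act hc⟩
  have hv : v ∈ e.1 := Sym2.mem_mk_left v _
  exact A.eq_of_act_eq (lev_color hv) hc (Sym2.congr_right.1 (eq_act_color hv)).symm

theorem color_surjective : Function.Surjective A.color := by
  intro c
  obtain ⟨v, hv⟩ := A.nonempty (D.lev c)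
  exact ⟨_, color_act hv.symm⟩

theorem ncard_neighborSet (v : A.V) : (A.graph.neighborSet v).ncard = D.size (A.lev v) := by
  have himage : A.graph.neighborSet v = (fun c => A.act c v) '' {c | D.lev c = A.lev v} := by
    ext w
    rfl
  rw [himage]
  exact Set.InjOn.ncard_image fun c hc d hd h => A.eq_of_act_eq hc hd h

/-- Consecutive edges of a trail are distinct, hence so are their colours. -/
theorem exists_isReduced_of_isTrail {u v : A.V} (p : A.graph.Walk u v) (hp : p.IsTrail) :
    ∃ l, D.IsReduced (A.lev v) l ∧ l.length = p.length ∧ l.foldr A.act v = u ∧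
      ∀ c ∈ l.head?, s(u, A.act c u) ∈ p.edges := by
  induction p with
  | nil => exact ⟨[], .nil, rfl, rfl, by simp⟩
  | @cons u w v h p ih =>
    rw [SimpleGraph.Walk.isTrail_cons] at hp
    obtain ⟨l, hl, hlen, rfl, hhead⟩ := ih hp.1
    obtain ⟨c, hc, hcu⟩ := h
    have hcw : A.act c (l.foldr A.act v) = u := by rw [← hcu, A.act_act]
    refine ⟨c :: l, hl.cons ?_ fun hlc => hp.2 ?_, congrArg _ hlen, hcw, ?_⟩
    · rw [hc, ← hcw, A.lev_act, A.lev_foldr_act]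
    · simpa only [hcw, Sym2.eq_swap] using hhead c hlc
    · rintro _ ⟨⟩
      exact List.mem_cons.2 (.inl (congrArg _ hcu))

variable (A) in
/-- The coding in which two edges are parallel if they have the same colour. -/
noncomputable def toCoding : Coding D where
  V := A.V
  lev := A.lev
  nonempty := A.nonempty
  finite := A.finite
  S := A.graph
  lev_eq_of_adj := by
    rintro u _ ⟨c, -, rfl⟩
    exact (A.lev_act c u).symm
  regular := ncard_neighborSet
  no_short_cycle v p hp := by
    obtain ⟨l, hl, hlen, hv, -⟩ := exists_isReduced_of_isTrail p hp.isTrail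
    refine lt_of_not_ge fun hle => A.foldr_act_ne l v ?_ hl (hlen.trans_le hle) hv
    exact List.length_pos_iff.1 (hlen ▸ zero_lt_three.trans_le hp.three_le_length)
  U := Setoid.ker A.color
  π := Setoid.quotientKerEquivOfSurjective A.color color_surjective
  lev_π _ _ hv := lev_color hv
  existsUnique_edge v q := by
    refine Quotient.inductionOn q fun e (he : D.lev (A.color e) = A.lev v) => ?_
    refine ⟨⟨s(v, A.act (A.color e) v), A.adj_act he⟩,
      ⟨Sym2.mem_mk_left _ _, Quotient.sound (color_act he)⟩, fun e' ⟨hv, he'⟩ => ?_⟩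
    have hcolor : A.color e' = A.color e := Quotient.exact he'
    exact Subtype.ext (by rw [eq_act_color hv, hcolor])

end Layering.LocallyFreeAction

namespace Layering

variable (D) {k N : ℕ}

/-- The reduced words over the `k`-th class of length at most `N`. -/
abbrev ReducedBall (k N : ℕ) : Type :=
  {l : List M // D.IsReduced k l ∧ l.length ≤ N}

instance : Finite (D.ReducedBall k N) := by
  have : Finite {c | D.lev c = k} := D.finite k
  refine (((List.finite_length_le {c | D.lev c = k} N).image (List.map Subtype.val)).subset ?_ :
    Set.Finite {l | D.IsReduced k l ∧ l.length ≤ N})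
  rintro l ⟨hl, hlen⟩
  lift l to List {c | D.lev c = k} using hl.2
  exact ⟨l, (List.length_map _).ge.trans hlen, rfl⟩

open Classical in
/-- Multiplication by a letter from the left in the ball of radius `N`, where it does not leave
the ball; the other words are fixed. -/
noncomputable def leftMul (c : M) (w : D.ReducedBall k N) : D.ReducedBall k N :=
  if h : (D.reduceCons k c w).length ≤ N then
    ⟨D.reduceCons k c w, D.isReduced_reduceCons c w.2.1, h⟩
  else w

theorem leftMul_leftMul (c : M) (w : D.ReducedBall k N) :
    D.leftMul c (D.leftMul c w) = w := by
  by_cases h : (D.reduceCons k c w).length ≤ N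
  · simp only [leftMul, h, dif_pos, D.reduceCons_reduceCons c w.2.1, w.2.2]
  · simp only [leftMul, h, dif_neg, not_false_eq_true]

/-- Multiplication by a letter from the left as a permutation of the ball of radius `N`. -/
noncomputable def leftPerm (k N : ℕ) (c : M) : Equiv.Perm (D.ReducedBall k N) :=
  Function.Involutive.toPerm (D.leftMul c) (D.leftMul_leftMul c)

variable {D} in
theorem IsReduced.prod_leftPerm_apply_nil {l : List M} (h : D.IsReduced k l) (hl : l.length ≤ N) :
    (l.map (D.leftPerm k N)).prod ⟨[], .nil, Nat.zero_le N⟩ = ⟨l, h, hl⟩ := by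
  induction l with
  | nil => rfl
  | cons c l ih =>
    have hcons : D.reduceCons k c l = c :: l :=
      D.reduceCons_eq_iff.2 (.inr ⟨h.2 c List.mem_cons_self,
        .inr ⟨fun hhead => (List.isChain_cons.1 h.1).1 c hhead rfl, rfl⟩⟩)
    rw [List.map_cons, List.prod_cons, Equiv.Perm.mul_apply,
      ih h.of_cons ((Nat.le_succ _).trans hl)]
    change D.leftMul c _ = _
    simp only [leftMul, hcons, hl, dif_pos]

/-- The permutations of the ball of reduced words, on which the letters act by multiplication: a
reduced word `l` fixing some permutation would be the trivial permutation, which does not move the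
empty word to `l`. -/
noncomputable def permAction : D.LocallyFreeAction where
  V := Σ k, Equiv.Perm (D.ReducedBall k (D.size k))
  lev := Sigma.fst
  nonempty k := ⟨⟨k, 1⟩, rfl⟩
  finite k := by
    refine (Set.finite_range (Sigma.mk k)).subset ?_
    rintro ⟨_, g⟩ rfl
    exact ⟨g, rfl⟩
  act c v := ⟨v.1, D.leftPerm _ _ c * v.2⟩
  lev_act _ _ := rfl
  act_act c v := Sigma.ext rfl (heq_of_eq (Equiv.ext fun w => D.leftMul_leftMul c _))
  foldr_act_ne l v hne hl hlen h := by
    have hfoldr : l.foldr (fun c (v : Σ k, Equiv.Perm (D.ReducedBall k (D.size k))) =>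
        ⟨v.1, D.leftPerm _ _ c * v.2⟩) v = ⟨v.1, (l.map (D.leftPerm _ _)).prod * v.2⟩ := by
      clear hne hl hlen h
      induction l with
      | nil => simp
      | cons c l ih => rw [List.foldr_cons, ih, List.map_cons, List.prod_cons, mul_assoc]
    have hprod := mul_eq_right.1 (eq_of_heq (Sigma.ext_iff.1 (hfoldr.symm.trans h)).2)
    have hnil := hl.prod_leftPerm_apply_nil hlen
    rw [hprod] at hnil
    exact hne (congrArg Subtype.val hnil).symm

end Layering

theorem nonempty_coding (D : Layering M E) : Nonempty (Coding D) :=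
  ⟨D.permAction.toCoding⟩

end Existence

section LongestCommonPrefix

variable {α : Type*} [DecidableEq α]

/-- The length of the longest common prefix of two lists: the height at which two nodes of a tree
of finite sequences branch. -/
def lcp : List α → List α → ℕ
  | a :: x, b :: y => if a = b then lcp x y + 1 else 0
  | [], _ => 0
  | _ :: _, [] => 0

theorem le_lcp_iff {k : ℕ} {x y : List α} :
    k ≤ lcp x y ↔ ∀ i < k, ∃ b, x[i]? = some b ∧ y[i]? = some b := by
  induction x generalizing y k with
  | nil => exact k.casesOn (by simp) fun k => by rw [Nat.forall_lt_succ_left]; simp [lcp]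
  | cons a x ih =>
    rcases k with _ | k
    · simp
    rw [Nat.forall_lt_succ_left]
    rcases y with _ | ⟨b, y⟩
    · simp [lcp]
    · by_cases hab : b = a <;> simp [lcp, hab, ih, eq_comm (b := b)]

theorem lt_lcp_iff {k : ℕ} {x y : List α} :
    k < lcp x y ↔ k ≤ lcp x y ∧ ∃ b, x[k]? = some b ∧ y[k]? = some b := by
  rw [← Nat.succ_le_iff, le_lcp_iff, le_lcp_iff, Nat.forall_lt_succ_right]

theorem lcp_comm (x y : List α) : lcp x y = lcp y x :=
  eq_of_forall_le_iff fun k => by simp only [le_lcp_iff, and_comm]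

theorem lcp_self (x : List α) : lcp x x = x.length := by
  induction x with
  | nil => rfl
  | cons a x ih => simp [lcp, ih]

theorem min_le_lcp (x y z : List α) : min (lcp x y) (lcp y z) ≤ lcp x z := by
  refine le_lcp_iff.2 fun i hi => ?_
  rw [lt_min_iff] at hi
  obtain ⟨b, hxb, hyb⟩ := le_lcp_iff.1 hi.1 i i.lt_succ_self
  obtain ⟨c, hyc, hzc⟩ := le_lcp_iff.1 hi.2 i i.lt_succ_self
  rw [hyb, Option.some_inj] at hyc
  exact ⟨b, hxb, hyc ▸ hzc⟩

theorem lcp_le_length_left (x y : List α) : lcp x y ≤ x.length := by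
  have h := min_le_lcp x y x
  rwa [lcp_comm y x, min_self, lcp_self] at h

theorem lcp_le_length_right (x y : List α) : lcp x y ≤ y.length :=
  (lcp_comm x y).trans_le (lcp_le_length_left y x)

theorem lcp_eq_min {x y z : List α} (h : lcp x z ≤ lcp x y) :
    lcp x z = min (lcp x y) (lcp y z) := by
  refine le_antisymm (le_min h ?_) (min_le_lcp x y z)
  have h' := min_le_lcp y x z
  rwa [lcp_comm y x, min_eq_right h] at h'

theorem isPrefix_iff_length_le_lcp {x y : List α} : x <+: y ↔ x.length ≤ lcp x y := by
  rw [List.prefix_iff_getElem?, le_lcp_iff]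
  refine forall₂_congr fun i hi => ?_
  simp [List.getElem?_eq_getElem hi, eq_comm]

theorem eq_iff_length_le_lcp {x y : List α} :
    x = y ↔ x.length ≤ lcp x y ∧ y.length ≤ lcp x y := by
  refine ⟨by rintro rfl; simp [lcp_self], fun h => ?_⟩
  rw [lcp_comm x y, ← isPrefix_iff_length_le_lcp, lcp_comm y x, ← isPrefix_iff_length_le_lcp] at h
  exact h.1.eq_of_length (le_antisymm h.1.length_le h.2.length_le)

theorem lcp_append_left {x y : List α} (h : y.length ≤ x.length) (w : List α) :
    lcp (x ++ w) y = lcp x y := by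
  refine eq_of_forall_le_iff fun k => ?_
  simp only [le_lcp_iff]
  refine forall₂_congr fun i _ => exists_congr fun b => and_congr_left fun hb => ?_
  have hi : i < y.length := (List.getElem?_eq_some_iff.1 hb).1
  rw [List.getElem?_append_left (hi.trans_le h)]

theorem lcp_take_append_eq_min {ι : Type*} {z : ι → List α} {x w : List α} {n : ℕ}
    (hn : n ≤ x.length) (hw : ∀ j, n ≤ lcp x (z j) → ∀ b ∈ w[0]?, (z j)[n]? ≠ some b) (j : ι) :
    lcp (x.take n ++ w) (z j) = min n (lcp x (z j)) := by
  set y := x.take n ++ w with hy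
  have hlen : (x.take n).length = n := by simp [hn]
  have hyx : n ≤ lcp y x := by
    refine le_lcp_iff.2 fun k hk => ⟨x[k], ?_, List.getElem?_eq_getElem (by omega)⟩
    rw [hy, List.getElem?_append_left (by omega), List.getElem?_take_of_lt hk,
      List.getElem?_eq_getElem]
  have hxyz := min_le_lcp x y (z j)
  have hyxz := min_le_lcp y x (z j)
  rw [lcp_comm x y] at hxyz
  have hle : lcp y (z j) ≤ n := by
    by_contra! hlt
    obtain ⟨-, b, hyb, hzb⟩ := lt_lcp_iff.1 hlt
    rw [hy, List.getElem?_append_right hlen.le, hlen, Nat.sub_self] at hyb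
    exact hw j (by omega) b hyb hzb
  omega

end LongestCommonPrefix

section Similarity

/-- The order relations and the differences up to `N` agree in two families of numbers. -/
def NumSim {ι : Type*} (N : ℕ) (ν ν' : ι → ℕ) : Prop :=
  ∀ p q, ∀ k ≤ N, ν p + k ≤ ν q ↔ ν' p + k ≤ ν' q

namespace NumSim

variable {ι κ : Type*} {N : ℕ} {ν ν' : ι → ℕ}

theorem symm (h : NumSim N ν ν') : NumSim N ν' ν :=
  fun p q k hk => (h p q k hk).symm

theorem mono {N' : ℕ} (h : NumSim N ν ν') (hN : N' ≤ N) : NumSim N' ν ν' :=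
  fun p q k hk => h p q k (hk.trans hN)

theorem reindex (h : NumSim N ν ν') {μ μ' : κ → ℕ} (hr : ∀ p, ∃ r, μ p = ν r ∧ μ' p = ν' r) :
    NumSim N μ μ' := by
  intro p q k hk
  obtain ⟨r, hpr, hpr'⟩ := hr p
  obtain ⟨s, hqs, hqs'⟩ := hr q
  rw [hpr, hpr', hqs, hqs']
  exact h r s k hk

theorem of_split {B n n' : ℕ} (hn : B + N < n) (hn' : B + N < n')
    (h : ∀ p, ν p = ν' p ∧ ν p ≤ B ∨ ν p = n ∧ ν' p = n') : NumSim N ν ν' := by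
  intro p q k hk
  rcases h p with hp | hp <;> rcases h q with hq | hq <;> omega

theorem option {n n' : ℕ} (h : NumSim N ν ν')
    (hn : ∀ q, ∀ k ≤ N, (n + k ≤ ν q ↔ n' + k ≤ ν' q) ∧ (ν q + k ≤ n ↔ ν' q + k ≤ n')) :
    NumSim N (fun p : Option ι => p.elim n ν) (fun p : Option ι => p.elim n' ν') := by
  rintro (_ | p) (_ | q) k hk
  · simp only [Option.elim_none]
    omega
  · exact (hn q k hk).1
  · exact (hn p k hk).2
  · exact h p q k hk

theorem exists_option [Finite ι] (h : NumSim (2 * N + 2) ν ν') {o : ι} (ho : ν o = 0)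
    (ho' : ν' o = 0) (n : ℕ) :
    ∃ n', NumSim N (fun p : Option ι => p.elim n ν) (fun p : Option ι => p.elim n' ν') := by
  suffices ∃ n', ∀ q, ∀ k ≤ N, (n + k ≤ ν q ↔ n' + k ≤ ν' q) ∧ (ν q + k ≤ n ↔ ν' q + k ≤ n') from
    this.imp fun _ => (h.mono (by omega)).option
  by_cases habove : ∃ p, ∃ d ≤ N, n = ν p + d
  · obtain ⟨p, d, hd, rfl⟩ := habove
    refine ⟨ν' p + d, fun q k hk => ?_⟩
    have hpq := h p q (d + k) (by omega)
    have hqp := h q p (k - d) (by omega)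
    have hpq' := h p q (d - k + 1) (by omega)
    omega
  by_cases hbelow : ∃ p, ∃ d ≤ N, n + d = ν p
  · obtain ⟨p, d, hd, hp⟩ := hbelow
    have hop := h o p d (by omega)
    refine ⟨ν' p - d, fun q k hk => ?_⟩
    have hqp := h q p (d + k) (by omega)
    have hpq := h p q (k - d) (by omega)
    have hqp' := h q p (d - k + 1) (by omega)
    omega
  obtain ⟨p, hp : ν p ≤ n, hmax⟩ := Set.exists_max_image {p | ν p ≤ n} ν (Set.toFinite _)
    ⟨o, by simp [ho]⟩
  have hfar (q : ι) : ν q + N < n ∨ n + N < ν q := by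
    by_contra hq
    rcases le_total (ν q) n with hle | hle
    · exact habove ⟨q, n - ν q, by omega, by omega⟩
    · exact hbelow ⟨q, ν q - n, by omega, by omega⟩
  refine ⟨ν' p + N + 1, fun q k hk => ?_⟩
  have hpn := hfar p
  have hqp := h q p 0 (by omega)
  have hpq := h p q (2 * N + 2) le_rfl
  rcases hfar q with hq | hq
  · have hqmax := hmax q (show ν q ≤ n by omega)
    omega
  · omega

end NumSim

/-- The heights at which the members of a family of nodes branch; the pair `(i, i)` gives the
length of the `i`-th member. -/
def meets {ι α : Type*} [DecidableEq α] (w : ι → List α) (p : ι × ι) : ℕ :=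
  lcp (w p.1) (w p.2)

variable {ι : Type*}

/-- The node of height `n` on the path to `x` has a successor that lies on the path to no member
of the family `z`. -/
def HasFreeSuccessor (z : ι → List Bool) (x : List Bool) (n : ℕ) : Prop :=
  ∃ b, ∀ j, n ≤ lcp x (z j) → (z j)[n]? ≠ some b

theorem hasFreeSuccessor_iff {x : List Bool} {z : ι → List Bool} {n : ℕ} :
    HasFreeSuccessor z x n ↔
      ∀ j k, n ≤ lcp x (z j) → n ≤ lcp x (z k) → n < (z j).length → n < (z k).length →
        n < lcp (z j) (z k) := by
  constructor
  · rintro ⟨b, hb⟩ j k hj hk hnj hnk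
    have hvalue (i : ι) (hi : n ≤ lcp x (z i)) (hni : n < (z i).length) : (z i)[n]? = some !b := by
      have hne := hb i hi
      rw [List.getElem?_eq_getElem hni] at hne ⊢
      exact congrArg some (Bool.eq_not.2 fun h => hne (congrArg some h))
    have hjk := min_le_lcp (z j) x (z k)
    rw [lcp_comm _ x] at hjk
    exact lt_lcp_iff.2 ⟨(le_min hj hk).trans hjk, !b, hvalue j hj hnj, hvalue k hk hnk⟩
  · intro h
    by_contra hc
    rw [HasFreeSuccessor] at hc
    push Not at hc
    obtain ⟨j, hj, hjb⟩ := hc false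
    obtain ⟨k, hk, hkb⟩ := hc true
    obtain ⟨-, b, hb, hb'⟩ := lt_lcp_iff.1 <| h j k hj hk
      (List.getElem?_eq_some_iff.1 hjb).1 (List.getElem?_eq_some_iff.1 hkb).1
    rw [hjb] at hb
    rw [hkb, ← hb] at hb'
    cases hb'

theorem HasFreeSuccessor.of_lcp {x x' : List Bool} {z z' : ι → List Bool} {n n' : ℕ}
    (h : HasFreeSuccessor z x n) (hx : ∀ j, n ≤ lcp x (z j) ↔ n' ≤ lcp x' (z' j))
    (hz : ∀ j k, n < lcp (z j) (z k) ↔ n' < lcp (z' j) (z' k)) : HasFreeSuccessor z' x' n' := by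
  rw [hasFreeSuccessor_iff] at h ⊢
  simpa only [← lcp_self, hx, hz] using h

theorem hasFreeSuccessor_of_lt_length {x y : List Bool} {z : ι → List Bool} {n : ℕ}
    (hx : n ≤ lcp y x) (hz : ∀ j, lcp y (z j) ≤ n) (hy : n < y.length) : HasFreeSuccessor z x n :=
  ⟨y[n], fun j hj hb => (hz j).not_gt <| lt_lcp_iff.2
    ⟨(le_min hx hj).trans (min_le_lcp y x (z j)), y[n], List.getElem?_eq_getElem hy, hb⟩⟩

theorem exists_length_eq_and_lcp_eq_min {z : ι → List Bool} {x : List Bool} {n m : ℕ}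
    (hn : n ≤ x.length) (hnm : n ≤ m) (hfree : n < m → HasFreeSuccessor z x n) :
    ∃ y : List Bool, y.length = m ∧ ∀ j, lcp y (z j) = min n (lcp x (z j)) := by
  obtain ⟨w, hlen, hw⟩ : ∃ w : List Bool, w.length = m - n ∧
      ∀ j, n ≤ lcp x (z j) → ∀ b ∈ w[0]?, (z j)[n]? ≠ some b := by
    rcases hnm.eq_or_lt with rfl | hlt
    · exact ⟨[], by simp⟩
    · obtain ⟨b, hb⟩ := hfree hlt
      refine ⟨List.replicate (m - n) b, by simp, fun j hj c hc => ?_⟩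
      rw [List.getElem?_replicate_of_lt (by omega), Option.mem_some_iff] at hc
      exact hc ▸ hb j hj
  exact ⟨x.take n ++ w, by simp [hlen, hn, hnm], lcp_take_append_eq_min hn hw⟩

/-- The new node is determined by its length and the height at which it leaves the tree spanned by
the old ones. It may leave at a node of that tree which has a free successor, and whether it has
one is visible from the branching heights, because there are only two successors. -/
theorem exists_numSim_meets_option [Finite ι] {N : ℕ} {w w' : ι → List Bool} {o : ι}
    (ho : w o = []) (ho' : w' o = []) (h : NumSim (2 * (2 * N + 2) + 2) (meets w) (meets w'))
    (y : List Bool) : ∃ y' : List Bool,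
      NumSim N (meets fun i : Option ι => i.elim y w) (meets fun i : Option ι => i.elim y' w') := by
  have : Nonempty ι := ⟨o⟩
  obtain ⟨i, hi⟩ := Finite.exists_max fun i => lcp y (w i)
  set n := lcp y (w i)
  have hmin (j : ι) : lcp y (w j) = min n (lcp (w i) (w j)) := lcp_eq_min (hi j)
  have hzero : meets w (o, o) = 0 := by rw [meets, ho, lcp_self, List.length_nil]
  have hzero' : meets w' (o, o) = 0 := by rw [meets, ho', lcp_self, List.length_nil]
  obtain ⟨n', hn'⟩ := h.exists_option hzero hzero' n
  obtain ⟨m', hm'⟩ := hn'.exists_option (o := some (o, o)) hzero hzero' y.length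
  have hle (j k : ι) : n ≤ lcp (w j) (w k) ↔ n' ≤ lcp (w' j) (w' k) :=
    hn' none (some (j, k)) 0 (Nat.zero_le _)
  have hlt (j k : ι) : n < lcp (w j) (w k) ↔ n' < lcp (w' j) (w' k) :=
    hn' none (some (j, k)) 1 (by omega)
  have hlength : n < y.length ↔ n' < m' :=
    lt_iff_lt_of_le_iff_le (hm' none (some none) 0 (Nat.zero_le _))
  have hnm' : n' ≤ m' :=
    (hm' (some none) none 0 (Nat.zero_le _)).1 (lcp_le_length_left _ _)
  obtain ⟨y', hy', hmin'⟩ := exists_length_eq_and_lcp_eq_min (z := w') (x := w' i)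
    (by rw [← lcp_self, ← hle, lcp_self]; exact lcp_le_length_right y (w i)) hnm' fun hlt' =>
      (hasFreeSuccessor_of_lt_length le_rfl hi (hlength.2 hlt')).of_lcp (hle i) hlt
  have hnew (j : ι) : ∃ r : Option (Option (ι × ι)),
      lcp y (w j) = r.elim y.length (fun p => p.elim n (meets w)) ∧
        lcp y' (w' j) = r.elim m' (fun p => p.elim n' (meets w')) := by
    rw [hmin j, hmin' j]
    by_cases hj : n ≤ lcp (w i) (w j)
    · exact ⟨some none, min_eq_left hj, min_eq_left ((hle i j).1 hj)⟩
    · exact ⟨some (some (i, j)), min_eq_right (le_of_not_ge hj),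
        min_eq_right (le_of_not_ge (mt (hle i j).2 hj))⟩
  refine ⟨y', hm'.reindex ?_⟩
  rintro ⟨_ | j, _ | k⟩
  · exact ⟨none, lcp_self y, (lcp_self y').trans hy'⟩
  · exact hnew k
  · change ∃ r, lcp (w j) y = _ ∧ lcp (w' j) y' = _
    rw [lcp_comm _ y, lcp_comm _ y']
    exact hnew j
  · exact ⟨some (some (j, k)), rfl, rfl⟩

end Similarity

section Tree

/-- A tuple of nodes together with the root, which plays the role of the number `0` in comparisons
of heights. -/
def withRoot {α γ : Type*} (z : γ → List α) (o : Option γ) : List α :=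
  o.elim [] z

/-- The tuples span trees with the same branching, in which the differences of the heights agree
up to `N`. -/
def Sim {α γ : Type*} [DecidableEq α] (N : ℕ) (z z' : γ → List α) : Prop :=
  NumSim N (meets (withRoot z)) (meets (withRoot z'))

theorem Sim.comp {α γ δ : Type*} [DecidableEq α] {N : ℕ} {z z' : γ → List α} (h : Sim N z z')
    (g : δ → γ) : Sim N (z ∘ g) (z' ∘ g) := by
  refine h.reindex fun p => ⟨(p.1.map g, p.2.map g), ?_⟩
  rcases p with ⟨_ | p, _ | q⟩ <;> exact ⟨rfl, rfl⟩

theorem Sim.exists_option {N : ℕ} {γ : Type*} [Finite γ] {z z' : γ → List Bool}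
    (h : Sim (2 * (2 * N + 2) + 2) z z') (y : List Bool) :
    ∃ y', Sim N (fun o : Option γ => o.elim y z) (fun o : Option γ => o.elim y' z') := by
  obtain ⟨y', hy'⟩ := exists_numSim_meets_option (o := none) rfl rfl h y
  let swap (o : Option (Option γ)) : Option (Option γ) := o.elim (some none) (Option.map some)
  have hswap (x : List Bool) (z : γ → List Bool) (o : Option (Option γ)) :
      withRoot (fun o : Option γ => o.elim x z) o = (swap o).elim x (withRoot z) := by
    rcases o with _ | _ | j <;> rfl
  refine ⟨y', hy'.reindex fun p => ⟨(swap p.1, swap p.2), ?_⟩⟩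
  simp only [meets, hswap, and_self]

instance : treeLanguage.IsRelational := fun _ => inferInstanceAs (IsEmpty Empty)

theorem Sim.relMap_iff {n : ℕ} (R : TreeRel n) {z z' : Fin n → List Bool} (h : Sim 0 z z') :
    Structure.RelMap (L := treeLanguage) R z ↔ Structure.RelMap (L := treeLanguage) R z' := by
  have hle (i j k l : Fin n) : lcp (z i) (z j) ≤ lcp (z k) (z l) ↔
      lcp (z' i) (z' j) ≤ lcp (z' k) (z' l) := h (some i, some j) (some k, some l) 0 le_rfl
  rcases R with _ | _
  · change z 0 <+: z 1 ↔ z' 0 <+: z' 1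
    simp only [isPrefix_iff_length_le_lcp, ← lcp_self, hle]
  · change (z 0).length = (z 1).length ↔ (z' 0).length = (z' 1).length
    simp only [← lcp_self, le_antisymm_iff, hle]

theorem Sim.eq_iff {α γ : Type*} [DecidableEq α] {N : ℕ} {z z' : γ → List α} (h : Sim N z z')
    (a b : γ) : z a = z b ↔ z' a = z' b := by
  have hle (i j k l : γ) : lcp (z i) (z j) ≤ lcp (z k) (z l) ↔
      lcp (z' i) (z' j) ≤ lcp (z' k) (z' l) := h (some i, some j) (some k, some l) 0 N.zero_le
  simp only [eq_iff_length_le_lcp, ← lcp_self, hle]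

theorem exists_realize_boundedFormula_iff_of_sim {α : Type*} [Finite α] {n : ℕ}
    (φ : treeLanguage.BoundedFormula α n) :
    ∃ N, ∀ (v v' : α → List Bool) (xs xs' : Fin n → List Bool),
      Sim N (Sum.elim v xs) (Sum.elim v' xs') → (φ.Realize v xs ↔ φ.Realize v' xs') := by
  induction φ with
  | falsum => exact ⟨0, fun _ _ _ _ _ => Iff.rfl⟩
  | equal t t' =>
    obtain ⟨a, rfl⟩ := exists_eq_var t
    obtain ⟨b, rfl⟩ := exists_eq_var t'
    exact ⟨0, fun _ _ _ _ h => h.eq_iff a b⟩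
  | rel R ts =>
    choose a ha using fun i => exists_eq_var (ts i)
    obtain rfl : ts = fun i => Term.var (a i) := funext ha
    exact ⟨0, fun _ _ _ _ h => (h.comp a).relMap_iff R⟩
  | imp φ ψ ihφ ihψ =>
    obtain ⟨N, hN⟩ := ihφ
    obtain ⟨N', hN'⟩ := ihψ
    refine ⟨max N N', fun v v' xs xs' h => ?_⟩
    exact imp_congr (hN _ _ _ _ (h.mono (le_max_left _ _)))
      (hN' _ _ _ _ (h.mono (le_max_right _ _)))
  | @all n φ ih =>
    obtain ⟨N, hN⟩ := ih
    let τ : α ⊕ Fin (n + 1) → Option (α ⊕ Fin n) :=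
      Sum.elim (fun a => some (.inl a)) (Fin.snoc (fun i => some (.inr i)) none)
    have hsnoc (v : α → List Bool) (xs : Fin n → List Bool) (y : List Bool) :
        Sum.elim v (Fin.snoc xs y : Fin (n + 1) → List Bool) =
          (fun o : Option (α ⊕ Fin n) => o.elim y (Sum.elim v xs)) ∘ τ := by
      funext a
      rcases a with a | i
      · rfl
      · refine Fin.lastCases ?_ (fun i => ?_) i <;> simp [τ]
    have hstep (v v' : α → List Bool) (xs xs' : Fin n → List Bool)
        (h : Sim (2 * (2 * N + 2) + 2) (Sum.elim v xs) (Sum.elim v' xs'))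
        (hall : ∀ y, φ.Realize v (Fin.snoc xs y)) (y : List Bool) :
        φ.Realize v' (Fin.snoc xs' y) := by
      obtain ⟨y', hy'⟩ := Sim.exists_option (NumSim.symm h) y
      refine (hN v' v _ _ ?_).2 (hall y')
      rw [hsnoc, hsnoc]
      exact hy'.comp τ
    exact ⟨_, fun v v' xs xs' h => ⟨hstep v v' xs xs' h, hstep v' v xs' xs (NumSim.symm h)⟩⟩

theorem exists_realize_iff_of_sim {α : Type*} [Finite α] (φ : treeLanguage.Formula α) :
    ∃ N, ∀ v v' : α → List Bool, Sim N v v' → (φ.Realize v ↔ φ.Realize v') := by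
  obtain ⟨N, hN⟩ := exists_realize_boundedFormula_iff_of_sim φ
  refine ⟨N, fun v v' h => hN v v' _ _ ?_⟩
  have hcomp (w : α → List Bool) (xs : Fin 0 → List Bool) :
      Sum.elim w xs = w ∘ Sum.elim id Fin.elim0 :=
    funext fun o => o.casesOn (fun _ => rfl) fun i => i.elim0
  rw [hcomp, hcomp]
  exact h.comp _

end Tree

section TreeNIP

universe u v

variable {X : Type u} {Y : Type v}

theorem PolyBounded.of_object (p : X → Prop) : PolyBounded fun x (_ : Y) => p x := by
  classical
  exact of_object_cover (I := Bool) (W := fun _ => Unit) (P := fun i _ _ => i = true) 0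
    (fun _ => of_subsingleton _) fun T _ _ _ x => ⟨decide (p x), (), Fin.elim0, fun _ => by simp⟩

theorem PolyBounded.min_add_le_min (k : ℕ∞) :
    PolyBounded fun w z : ℕ∞ × ℕ∞ => min w.1 z.1 + k ≤ min w.2 z.2 := by
  refine of_determined (I := Fin 3) (P := ![fun w _ => w.1 + k ≤ w.2, fun w z => w.1 + k ≤ z.2,
    fun w z => z.1 + k ≤ w.2]) (fun i => ?_) fun w w' z h => ?_
  · fin_cases i
    · exact of_object fun w : ℕ∞ × ℕ∞ => w.1 + k ≤ w.2
    · exact le.comp (fun w : ℕ∞ × ℕ∞ => w.1 + k) Prod.snd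
    · exact (le (A := ℕ∞ᵒᵈ)).comp (fun w : ℕ∞ × ℕ∞ => OrderDual.toDual w.2)
        fun z : ℕ∞ × ℕ∞ => OrderDual.toDual (z.1 + k)
  · have hobject : w.1 + k ≤ w.2 ↔ w'.1 + k ≤ w'.2 := h 0
    have hleft : w.1 + k ≤ z.2 ↔ w'.1 + k ≤ z.2 := h 1
    have hright : z.1 + k ≤ w.2 ↔ z.1 + k ≤ w'.2 := h 2
    have hmin (a b : ℕ∞) : min a b + k = min (a + k) (b + k) :=
      Monotone.map_min (f := fun c : ℕ∞ => c + k) fun _ _ h => add_le_add_left h k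
    simp only [hmin, le_min_iff, min_le_iff, hobject, hleft, hright]

/-- On every finite family of parameters, the function is the minimum of a number that depends on
the object and a function of the parameter that the object selects from finitely many, one for each
member of the family. -/
def MinSplit (τ : X → Y → ℕ) : Prop :=
  ∃ h : Y → Y → ℕ∞, ∀ (T : Type) [Finite T] [Nonempty T] (b : T → Y) (x : X),
    ∃ (s : T) (n : ℕ∞), ∀ t, (τ x (b t) : ℕ∞) = min n (h (b s) (b t))

theorem MinSplit.polyBounded {τ τ' : X → Y → ℕ} (h : MinSplit τ) (h' : MinSplit τ') (k : ℕ) :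
    PolyBounded fun x y => τ x y + k ≤ τ' x y := by
  obtain ⟨f, hf⟩ := h
  obtain ⟨f', hf'⟩ := h'
  let P (w : ℕ∞ × ℕ∞) (z : (Fin 2 → Y) × Y) : Prop :=
    min w.1 (f (z.1 0) z.2) + k ≤ min w.2 (f' (z.1 1) z.2)
  have hP : PolyBounded P := (PolyBounded.min_add_le_min k).comp id
    fun z : (Fin 2 → Y) × Y => (f (z.1 0) z.2, f' (z.1 1) z.2)
  refine PolyBounded.of_object_cover (I := Unit) (P := fun _ => P) 2 (fun _ => hP)
    fun T _ _ b x => ?_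
  obtain ⟨s, n, hn⟩ := hf T b x
  obtain ⟨s', n', hn'⟩ := hf' T b x
  refine ⟨(), (n, n'), ![s, s'], fun t => ?_⟩
  change _ ↔ min n (f (b s) (b t)) + k ≤ min n' (f' (b s') (b t))
  rw [← hn, ← hn']
  norm_cast

theorem MinSplit.of_object (f : X → ℕ) : MinSplit fun x (_ : Y) => f x :=
  ⟨fun _ _ => ⊤, fun _ _ hT _ x => ⟨hT.some, f x, fun _ => (min_top_right _).symm⟩⟩

theorem MinSplit.of_parameter (f : Y → ℕ) : MinSplit fun (_ : X) y => f y :=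
  ⟨fun _ y => f y, fun _ _ hT _ _ => ⟨hT.some, ⊤, fun _ => (min_top_left _).symm⟩⟩

theorem minSplit_lcp {α : Type*} [DecidableEq α] (f : X → List α) (g : Y → List α) :
    MinSplit fun x y => lcp (f x) (g y) := by
  refine ⟨fun y y' => lcp (g y) (g y'), fun T _ _ b x => ?_⟩
  obtain ⟨s, hs⟩ := Finite.exists_max fun t => lcp (f x) (g (b t))
  refine ⟨s, lcp (f x) (g (b s)), fun t => ?_⟩
  exact (congrArg Nat.cast (lcp_eq_min (hs t))).trans Nat.mono_cast.map_min

theorem minSplit_meets {β γ α : Type*} [DecidableEq α] (p : Option (γ ⊕ β) × Option (γ ⊕ β)) :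
    MinSplit fun (x : β → List α) (y : γ → List α) => meets (withRoot (Sum.elim y x)) p := by
  rcases p with ⟨_ | p | p, _ | q | q⟩
  · exact .of_object fun _ => 0
  · exact .of_object fun _ => 0
  · exact .of_object fun _ => 0
  · exact .of_parameter fun y : γ → List α => lcp (y p) []
  · exact .of_parameter fun y : γ → List α => lcp (y p) (y q)
  · refine cast (congrArg MinSplit ?_)
      (minSplit_lcp (fun x : β → List α => x q) fun y : γ → List α => y p)
    exact funext fun x => funext fun y => lcp_comm _ _
  · exact .of_object fun x : β → List α => lcp (x p) []
  · exact minSplit_lcp (fun x : β → List α => x p) fun y : γ → List α => y q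
  · exact .of_object fun x : β → List α => lcp (x p) (x q)

theorem tree_isNIP : IsNIP (treeLanguage.completeTheory (List Bool)) := by
  refine isNIP_of_polyBounded fun n m φ => ?_
  obtain ⟨N, hN⟩ := exists_realize_iff_of_sim φ
  let ι := Option (Fin n ⊕ Fin m) × Option (Fin n ⊕ Fin m)
  refine PolyBounded.of_determined (I := (ι × ι) × Fin (N + 1))
    (fun i => (minSplit_meets i.1.1).polyBounded (minSplit_meets i.1.2) i.2) fun x x' y h => ?_
  exact hN _ _ fun p q k hk => h ((p, q), ⟨k, Nat.lt_succ_of_le hk⟩)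

end TreeNIP

section TreeTypes

theorem Sim.append {α γ : Type*} [DecidableEq α] {N B : ℕ} {c : List α} (hc : B + N < c.length)
    (w : List α) {z z' : γ → List α}
    (hz : ∀ i, z i = c ++ w ∧ z' i = c ∨ z i = z' i ∧ (z i).length ≤ B) : Sim N z z' := by
  have hroot (o : Option γ) : withRoot z o = c ++ w ∧ withRoot z' o = c ∨
      withRoot z o = withRoot z' o ∧ (withRoot z o).length ≤ B :=
    o.casesOn (Or.inr ⟨rfl, B.zero_le⟩) hz
  have hlcp {y : List α} (hy : y.length ≤ B) : lcp (c ++ w) y = lcp c y :=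
    lcp_append_left (by omega) w
  refine NumSim.of_split (B := B) (n := (c ++ w).length) (n' := c.length)
    (by rw [List.length_append]; omega) hc fun p => ?_
  simp only [meets]
  rcases hroot p.1 with ⟨h₁, h₁'⟩ | ⟨h₁, hB⟩ <;> rcases hroot p.2 with ⟨h₂, h₂'⟩ | ⟨h₂, hB'⟩
  · exact .inr ⟨by rw [h₁, h₂, lcp_self], by rw [h₁', h₂', lcp_self]⟩
  · exact .inl ⟨by rw [h₁, h₁', ← h₂, hlcp hB'], (lcp_le_length_right _ _).trans hB'⟩
  · exact .inl ⟨by rw [h₂, h₂', ← h₁, lcp_comm, hlcp hB, lcp_comm],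
      (lcp_le_length_left _ _).trans hB⟩
  · exact .inl ⟨by rw [h₁, h₂], (lcp_le_length_left _ _).trans hB⟩

theorem ParamDefinable.exists_append_iff {P : (Unit → List Bool) → Prop}
    (hP : ParamDefinable treeLanguage P) :
    ∃ K, ∀ c w : List Bool, K ≤ c.length → (P (fun _ => c ++ w) ↔ P fun _ => c) := by
  obtain ⟨n, g, φ, hφ⟩ := hP.exists_formula_fin
  obtain ⟨N, hN⟩ := exists_realize_iff_of_sim φ
  obtain ⟨B, hB⟩ := (Set.finite_range fun i => (Sum.elim (fun _ => []) id (g i)).length).bddAbove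
  refine ⟨B + N + 1, fun c w hc => ?_⟩
  rw [hφ, hφ]
  refine hN _ _ (Sim.append (B := B) hc w fun i => ?_)
  have hi : (Sum.elim (fun _ => []) id (g i)).length ≤ B := hB ⟨i, rfl⟩
  generalize g i = a at hi ⊢
  rcases a with _ | y
  · exact .inl ⟨rfl, rfl⟩
  · exact .inr ⟨rfl, hi⟩

theorem eventually_iff_exists_forall_isPrefix {P : List Bool → Prop}
    (hP : ParamDefinable treeLanguage fun v : Unit → List Bool => P (v ()))
    (hlevel : ∀ x y : List Bool, x.length = y.length → (P x ↔ P y)) {ι : Type*} {l : Filter ι}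
    [l.NeBot] {f : ι → List Bool} (hf : Filter.Tendsto (fun i => (f i).length) l Filter.atTop) :
    (∀ᶠ i in l, P (f i)) ↔ ∃ c, ∀ e, c <+: e → P e := by
  constructor
  · intro h
    obtain ⟨K, hK⟩ := hP.exists_append_iff
    obtain ⟨i, hi, hKi⟩ := (h.and (hf.eventually_ge_atTop K)).exists
    exact ⟨f i, fun e ⟨w, hw⟩ => hw ▸ (hK _ w hKi).2 hi⟩
  · rintro ⟨c, hc⟩
    filter_upwards [hf.eventually_ge_atTop c.length] with i hi
    refine (hlevel _ (c ++ List.replicate ((f i).length - c.length) false) ?_).2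
      (hc _ (List.prefix_append _ _))
    rw [List.length_append, List.length_replicate, Nat.add_sub_cancel' hi]

theorem ParamDefinable.realize_single {L : FirstOrder.Language} {M : Type*} [L.Structure M] {m : ℕ}
    {δ : Type*} (φ : L.Formula (Fin 1 ⊕ Fin m)) (a : δ) (t : Fin m → δ ⊕ M) :
    ParamDefinable L fun v : δ → M =>
      φ.Realize (Sum.elim ![v a] fun j => Sum.elim v id (t j)) := by
  refine ((ParamDefinable.of_formula φ).subst (Sum.elim (fun _ => .inl a) t)).congr fun v => ?_
  refine iff_of_eq (congrArg φ.Realize (funext ?_))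
  rintro (i | j)
  · fin_cases i
    rfl
  · rfl

theorem tree_newClassTypesDefinable : NewClassTypesDefinable (List Bool) treeE := by
  intro p hp m φ hφ
  obtain ⟨u, hu⟩ := exists_ultrafilter_of_type p
  have hne (k : ℕ) : ∀ᶠ x : Fin 1 → List Bool in u, (x 0).length ≠ k := by
    have hk := hp (List.replicate k false)
    rw [hu, ← Ultrafilter.eventually_not] at hk
    refine hk.mono fun x hx hxk => hx (Formula.realize_rel₂.2 ?_)
    exact hxk.trans List.length_replicate.symm
  have hlength : Filter.Tendsto (fun x : Fin 1 → List Bool => (x 0).length) u Filter.atTop := by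
    rw [← Nat.cofinite_eq_atTop]
    exact Filter.le_cofinite_iff_eventually_ne.2 hne
  have hprefix : ParamDefinable treeLanguage fun v : Option (Option (Fin m)) → List Bool =>
      v (some none) <+: v none :=
    ParamDefinable.rel (L := treeLanguage) TreeRel.le ![some none, none]
  have hdef := (hprefix.imp
    (ParamDefinable.realize_single φ none fun j => .inl (some (some j)))).all.ex
  refine hdef.congr fun b => Iff.trans (Iff.symm ?_) (hu m φ b).symm
  have hsingle (x : Fin 1 → List Bool) : x = ![x 0] := funext fun i => by fin_cases i; rfl
  refine Iff.trans (Filter.eventually_congr (.of_forall fun x => ?_))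
    (eventually_iff_exists_forall_isPrefix (P := fun x => φ.Realize (Sum.elim ![x] b))
      (ParamDefinable.realize_single φ () fun j => .inr (b j)) (fun x y => hφ x y b) hlength)
  rw [← hsingle]

theorem not_paramDefinable_branch : ¬ ParamDefinable treeLanguage fun v : Unit → List Bool =>
    ∃ k, v () = List.replicate k true := by
  intro h
  obtain ⟨K, hK⟩ := h.exists_append_iff
  obtain ⟨k, hk : _ ++ _ = _⟩ := (hK _ [false] List.length_replicate.ge).2 ⟨K, rfl⟩
  have hfalse : false ∈ List.replicate K true ++ [false] := by simp
  rw [hk] at hfalse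
  exact Bool.false_ne_true (List.eq_of_mem_replicate hfalse)

end TreeTypes

section Branch

theorem Coding.paramDefinable_color {L : FirstOrder.Language.{0, 0}} {M : Type} [L.Structure M]
    {E : L.Relations 2} {D : Layering M E} (C : Coding D) {P : (Fin 2 → C.V) → Prop}
    (hP : ParamDefinable (codeLanguage L) P) : ParamDefinable L fun x : Unit → M =>
      ∃ (p q : C.V) (h : C.S.Adj p q), C.color h = x () ∧ P ![p, q] := by
  obtain ⟨n, g, φ, hφ⟩ := hP.exists_formula_fin
  have hvertices : Simple C (Option (Option Empty)) fun (_ : Unit → M) v =>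
      P ![v (some none), v none] := by
    refine ((Simple.of_codeFormula φ).subst fun i =>
      Sum.elim (fun j => Sum.inr ([], ![some none, none] j)) Sum.inl (g i)).congr fun x v => ?_
    refine (iff_of_eq (congrArg φ.Realize (funext fun i => ?_))).trans (hφ _).symm
    rcases g i with j | c
    · fin_cases j <;> rfl
    · rfl
  refine ((((Simple.color () (some none) none).and
    hvertices).exists_vertex.exists_vertex).paramDefinable Empty.elim).congr fun x => ?_
  exact exists_congr fun p => exists_congr fun q => exists_and_right.symm

theorem eventually_isPrefix_replicate_iff {α : Type*} {l : Filter ℕ} [l.NeBot]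
    (hl : l ≤ Filter.atTop) (a : α) (x : List α) :
    (∀ᶠ k in l, x <+: List.replicate k a) ↔ ∃ k, x = List.replicate k a := by
  constructor
  · intro h
    obtain ⟨k, hk⟩ := h.exists
    exact ⟨_, (List.prefix_replicate_iff.1 hk).2⟩
  · rintro ⟨k, rfl⟩
    filter_upwards [hl (Filter.eventually_ge_atTop k)] with j hj
    exact List.prefix_replicate_iff.2 ⟨by rwa [List.length_replicate], by simp⟩

variable (C : Coding treeLayering)

/-- The formula saying that the pairs `(a, b)` and `(c, d)` are edges and that the node coded by
the first lies below the node coded by the second. -/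
def codedLe {γ : Type*} (a b c d : γ) : treeCodeLanguage.Formula γ :=
  Relations.formula (L := treeCodeLanguage)
    (CodeRel.coded TreeRel.le : CodeRel treeLanguage (2 * 2))
    fun j => Term.var (!![a, b; c, d] (finProdFinEquiv.symm j).1 (finProdFinEquiv.symm j).2)

theorem realize_codedLe {γ : Type*} (a b c d : γ) (z : γ → C.V) :
    (codedLe a b c d).Realize z ↔
      ∃ (h : C.S.Adj (z a) (z b)) (h' : C.S.Adj (z c) (z d)), C.color h <+: C.color h' := by
  have hcoded (w : Fin (2 * 2) → C.V) (p q p' q' : C.V) (hp : w (finProdFinEquiv (0, 0)) = p)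
      (hq : w (finProdFinEquiv (0, 1)) = q) (hp' : w (finProdFinEquiv (1, 0)) = p')
      (hq' : w (finProdFinEquiv (1, 1)) = q') :
      C.relMap (CodeRel.coded TreeRel.le : CodeRel treeLanguage (2 * 2)) w ↔
        ∃ (h : C.S.Adj p q) (h' : C.S.Adj p' q'), C.color h <+: C.color h' := by
    subst hp hq hp' hq'
    exact ⟨fun ⟨h, hle⟩ => ⟨h 0, h 1, hle⟩,
      fun ⟨h, h', hle⟩ => ⟨Fin.forall_fin_two.2 ⟨h, h'⟩, hle⟩⟩
  refine (Formula.realize_rel).trans (hcoded _ _ _ _ _ ?_ ?_ ?_ ?_) <;> simp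

/-- The edge codes an element of the branch `1, 11, 111, …` of the tree. -/
def IsBranchEdge (v : Fin 2 → C.V) : Prop :=
  ∃ (h : C.S.Adj (v 0) (v 1)) (k : ℕ), C.color h = List.replicate k true

theorem not_paramDefinable_isBranchEdge :
    ¬ ParamDefinable treeCodeLanguage (IsBranchEdge C) := by
  refine fun h => not_paramDefinable_branch ((C.paramDefinable_color h).congr fun x => ?_)
  constructor
  · rintro ⟨p, q, h, hx, h', k, hk⟩
    exact ⟨k, hx.symm.trans hk⟩
  · rintro ⟨k, hk⟩
    obtain ⟨p, q, h, hx⟩ := C.exists_color_eq (x ())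
    exact ⟨p, q, h, hx, h, k, hx.trans hk⟩

theorem exists_eventually_isPrefix_color_iff_isBranchEdge : ∃ p q : ℕ → C.V, ∀ v : Fin 2 → C.V,
    (∀ᶠ k in (Filter.hyperfilter ℕ : Filter ℕ), ∃ (h : C.S.Adj (v 0) (v 1))
      (h' : C.S.Adj (p k) (q k)), C.color h <+: C.color h') ↔ IsBranchEdge C v := by
  choose p q hpq hcolor using fun k : ℕ => C.exists_color_eq (List.replicate k true)
  refine ⟨p, q, fun v => ?_⟩
  have hprefix (h : C.S.Adj (v 0) (v 1)) :
      (∀ᶠ k in (Filter.hyperfilter ℕ : Filter ℕ), C.color h <+: List.replicate k true) ↔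
        ∃ k, C.color h = List.replicate k true :=
    eventually_isPrefix_replicate_iff Nat.hyperfilter_le_atTop true _
  simp only [IsBranchEdge, hcolor, hpq, exists_true_left, ← hprefix]
  constructor
  · intro h
    obtain ⟨_, hadj, -⟩ := h.exists
    exact ⟨hadj, h.mono fun _ hk => hk.2⟩
  · rintro ⟨hadj, h⟩
    exact h.mono fun _ hk => ⟨hadj, hk⟩

theorem exists_not_isDefinableType {n : ℕ} (hn : 2 ≤ n) :
    ∃ p : TypeOver treeCodeLanguage C.V n, ¬ IsDefinableType p := by
  obtain ⟨p, q, hpq⟩ := exists_eventually_isPrefix_color_iff_isBranchEdge C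
  have : Nonempty C.V := ⟨p 0⟩
  obtain ⟨t, ht⟩ := exists_type_of_ultrafilter (L := treeCodeLanguage) (Filter.hyperfilter ℕ)
    fun (k : ℕ) (i : Fin n) => if i.1 = 0 then p k else q k
  refine ⟨t, fun h => not_paramDefinable_isBranchEdge C ?_⟩
  have hdef := h 2 (codedLe (.inr 0) (.inr 1) (.inl ⟨0, by omega⟩) (.inl ⟨1, hn⟩))
  refine ParamDefinable.congr hdef fun v => ?_
  refine (ht _ _ v).trans (Iff.trans ?_ (hpq v))
  exact Filter.eventually_congr (.of_forall fun k => realize_codedLe C _ _ _ _ _)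

theorem exists_not_infStablyEmbedded :
    ∃ (N : Type) (_ : treeCodeLanguage.Structure N) (f : C.V ↪ₑ[treeCodeLanguage] N),
      ∀ m : ℕ, 2 ≤ m → ¬ InfStablyEmbedded treeCodeLanguage (Set.range f) m := by
  obtain ⟨p, q, hpq⟩ := exists_eventually_isPrefix_color_iff_isBranchEdge C
  have : Nonempty C.V := ⟨p 0⟩
  let u := Filter.hyperfilter ℕ
  let N := (u : Filter ℕ).Product fun _ => C.V
  let φ : treeCodeLanguage.Formula (Fin 2 ⊕ Fin 2) := codedLe (.inl 0) (.inl 1) (.inr 0) (.inr 1)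
  refine ⟨N, inferInstance, diagonal treeCodeLanguage u, fun m hm h => ?_⟩
  have hdef := (infStablyEmbedded_range_iff _ m).1 h 2 2 hm φ ![(p : N), (q : N)]
  refine not_paramDefinable_isBranchEdge C (hdef.congr fun v => Iff.trans ?_ (hpq v))
  have hcast : Sum.elim (diagonal treeCodeLanguage u ∘ v) ![(p : N), (q : N)] =
      fun j => ((Sum.elim (fun i _ => v i) ![p, q] j : ℕ → C.V) : N) := by
    funext j
    rcases j with i | i
    · rfl
    · fin_cases i <;> rfl
  rw [hcast]
  refine (Ultraproduct.realize_formula_cast φ _).trans ?_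
  exact Filter.eventually_congr (.of_forall fun k => realize_codedLe C _ _ _ _ _)

end Branch

end GraphCoding

theorem mainTheorem8 :
    -- the general construction
    (∀ (L : FirstOrder.Language.{0, 0}) [L.IsRelational] (M : Type) [L.Structure M] (E : L.Relations 2)
        (D : GraphCoding.Layering M E),
      Nonempty (GraphCoding.Coding D) ∧
      ∀ C : GraphCoding.Coding D,
        (GraphCoding.IsNIP (L.completeTheory M) →
          GraphCoding.IsNIP ((GraphCoding.codeLanguage L).completeTheory C.V)) ∧
        (GraphCoding.NewClassTypesDefinable M E →
          ∀ p : GraphCoding.TypeOver (GraphCoding.codeLanguage L) C.V 1,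
            GraphCoding.IsDefinableType p)) ∧
    -- the example obtained from the binary tree
    Nonempty (GraphCoding.Coding GraphCoding.treeLayering) ∧
    ∀ C : GraphCoding.Coding GraphCoding.treeLayering,
      GraphCoding.IsNIP (GraphCoding.treeCodeLanguage.completeTheory C.V) ∧
      (∀ p : GraphCoding.TypeOver GraphCoding.treeCodeLanguage C.V 1,
        GraphCoding.IsDefinableType p) ∧
      (∀ n : ℕ, 2 ≤ n → ∃ p : GraphCoding.TypeOver GraphCoding.treeCodeLanguage C.V n,
        ¬ GraphCoding.IsDefinableType p) ∧
      (∀ (N : Type) [GraphCoding.treeCodeLanguage.Structure N] (f : C.V ↪ₑ[GraphCoding.treeCodeLanguage] N),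
        GraphCoding.InfStablyEmbedded GraphCoding.treeCodeLanguage (Set.range f) 1) ∧
      (∃ (N : Type) (_ : GraphCoding.treeCodeLanguage.Structure N) (f : C.V ↪ₑ[GraphCoding.treeCodeLanguage] N),
        ∀ m : ℕ, 2 ≤ m → ¬ GraphCoding.InfStablyEmbedded GraphCoding.treeCodeLanguage (Set.range f) m) := by
  refine ⟨fun L _ M _ E D => ⟨GraphCoding.nonempty_coding D, fun C => ⟨C.isNIP, C.isDefinableType⟩⟩,
    GraphCoding.nonempty_coding _, fun C => ⟨C.isNIP GraphCoding.tree_isNIP,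
      C.isDefinableType GraphCoding.tree_newClassTypesDefinable,
      fun n hn => GraphCoding.exists_not_isDefinableType C hn,
      fun N _ f => C.infStablyEmbedded_one GraphCoding.tree_newClassTypesDefinable f,
      GraphCoding.exists_not_infStablyEmbedded C⟩⟩
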